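/- Let $n,N\ge 1$, let $\mathbf D$ be a fixed (non-random) complex $n\times N$ matrix, and let $\mathbf X$ be an $n\times N$ standard complex Gaussian matrix, i.e. its entries are independent, each distributed as $a+b\,\mathrm i$ with $a,b$ independent real Gaussians of mean $0$ and variance $\tfrac12$. Let $\mathrm{tr}$ be the normalized trace, and put $$D_r=\mathrm{tr}\Big(\big(\tfrac1N\mathbf D\mathbf D^H\big)^r\Big),\qquad D_{p_1,\dots,p_k}=D_{p_1}\cdots D_{p_k}.$$ *Combinatorial notation.* Let $p_1,\dots,p_k\ge 1$ and $p=p_1+\cdots+p_k$. Let $\mathrm{SP}_p$ be the set of partial permutations $\pi=\pi(\rho_1,\rho_2,q)$ of $\{1,\dots,p\}$, i.e. bijections $q:\rho_1\to\rho_2$ between two (possibly empty) subsets of $\{1,\dots,p\}$. Draw $k$ disjoint circles with $2p_1,\dots,2p_k$ edges, and number the edges, and likewise the vertices, successively from $1$ to $2p$, so that edge $i$ goes from vertex $i$ to the next vertex of its circle (vertex $i+1$, cyclically within each circle). For every $i\in\rho_1$ with $q(i)=j$, identify the even edge $2i$ with the odd edge $2j-1$, with opposite orientation. Let $\rho(\pi)$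 be the resulting partition of the vertices; each block consists of even vertices only or of odd vertices only, and $k(\rho(\pi))$ and $l(\rho(\pi))$ are the numbers of even and of odd blocks. The edges $2i$ with $i\notin\rho_1$ and $2j-1$ with $j\notin\rho_2$ are called deterministic; $kd(\rho(\pi))$ and $ld(\rho(\pi))$ are the numbers of even and of odd blocks of $\rho(\pi)$ that border to a deterministic edge. Let $\sigma(\pi)$ be the partition of the set of deterministic edges into connected components (after the identification), $|\sigma(\pi)|$ its number of blocks, and $l_1,\dots,l_r$ the cardinalities of its blocks divided by $2$. For numbers $Y_1,Y_2,\dots$ write $Y_{l_1,\dots,l_r}=Y_{l_1}\cdots Y_{l_r}$, which is $1$ if $r=0$. Put $P_\pi(n,N)=N^{k(\rho(\pi))-kd(\rho(\pi))}\,n^{l(\rho(\pi))-ld(\rho(\pi))}$. **(1)** Let $\mathbf Y=\mathbf D+\mathbf X$ and $Y_r=\mathrm{tr}\big((\tfrac1N\mathbf Y\mathbf Y^H)^r\big)$. Then $$\widehat{D_{p_1,\dots,p_k}}=\sum_{\pi\in \mathrm{SP}_p}(-1)^{|\rho_1|}\,\frac{n^{|\sigma(\pi)|-k}}{N^{|\rho_1|}}\,P_\pi(n,N)\,Y_{l_1,\dots,l_r}$$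 is an unbiased estimator of $D_{p_1,\dots,p_k}$, i.e. it is integrable and $\mathbb E\big(\widehat{D_{p_1,\dots,p_k}}\big)=D_{p_1,\dots,p_k}$, for all $p_1,\dots,p_k\ge 1$. In particular, $\widehat{D_p}$ is an unbiased estimator of $D_p$ for every $p\ge1$. **(2)** Let $L_1,L_2\ge 1$, and let $\mathbf Y_1,\dots,\mathbf Y_{L_1L_2}$ be independent observations of the model, $\mathbf Y_l=\mathbf D+\mathbf X_l$ with independent $n\times N$ standard complex Gaussian matrices $\mathbf X_l$. Let $\mathbf Y_{L_1,L_2}$ be the $(nL_1)\times(NL_2)$ compound matrix obtained by placing the $L_1L_2$ observations, in any given order, as the blocks of an $L_1\times L_2$ block matrix, and now let $Y_r=\mathrm{tr}\big((\tfrac1{NL_2}\mathbf Y_{L_1,L_2}\mathbf Y_{L_1,L_2}^H)^r\big)$. Then $$\widehat{D_{p_1,\dots,p_k,L_1,L_2}}=L_1^{k-p_1-\cdots-p_k}\sum_{\pi\in \mathrm{SP}_p}(-1)^{|\rho_1|}\,\frac{(nL_1)^{|\sigma(\pi)|-k}}{(NL_2)^{|\rho_1|}}\,P_\pi(nL_1,NL_2)\,Y_{l_1,\dots,l_r}$$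 is also an unbiased estimator of $D_{p_1,\dots,p_k}$, for all $p_1,\dots,p_k\ge 1$. In particular, $\widehat{D_{p,L_1,L_2}}$ is an unbiased estimator of $D_p$ for every $p\ge1$. -/

import Mathlib

open MeasureTheory ProbabilityTheory
open scoped Matrix

namespace GaussEst

/-! ### Gaussian matrices, moments, unbiasedness -/

/-- The standard complex Gaussian law: the law of `a + b i` with `a`, `b` independent real
Gaussians of mean `0` and variance `1 / 2`. -/
noncomputable def stdComplexGaussian : Measure ℂ :=
  ((gaussianReal 0 (1 / 2)).prod (gaussianReal 0 (1 / 2))).map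
    (fun x : ℝ × ℝ => (⟨x.1, x.2⟩ : ℂ))

/-- `X` is a standard complex Gaussian random matrix: its entries are independent and each has
the standard complex Gaussian law. -/
structure IsStdComplexGaussian {Ω : Type*} [MeasurableSpace Ω] {m m' : Type*}
    (X : Ω → Matrix m m' ℂ) (μ : Measure Ω) : Prop where
  hasLaw : ∀ i j, HasLaw (fun ω => X ω i j) stdComplexGaussian μ
  indep : iIndepFun (fun (s : m × m') (ω : Ω) => X ω s.1 s.2) μ

/-- The normalized trace. -/
noncomputable def ntr {m : Type*} [Fintype m] (A : Matrix m m ℂ) : ℂ :=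
  A.trace / (Fintype.card m : ℂ)

/-- The `r`-th moment `tr (((1 / c) Y Yᴴ) ^ r)`, where `c` is the number of columns of `Y`. -/
noncomputable def covMoment {m m' : Type*} [Fintype m] [DecidableEq m] [Fintype m']
    (Y : Matrix m m' ℂ) (r : ℕ) : ℂ :=
  ntr (((Fintype.card m' : ℂ)⁻¹ • (Y * Yᴴ)) ^ r)

/-- `T` is an unbiased estimator of the number `θ`: it has a finite expectation, equal to `θ`. -/
def IsUnbiased {Ω : Type*} [MeasurableSpace Ω] (μ : Measure Ω) (T : Ω → ℂ) (θ : ℂ) : Prop :=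
  Integrable T μ ∧ ∫ ω, T ω ∂μ = θ

/-! ### Partial permutations and the identification of edges

For `p = (p₁, …, p_k)` the numbers `1, …, p₁ + ⋯ + p_k` are represented by pairs `⟨i, j⟩` with
`j < p i`; the pair stands for the `j`-th element of the `i`-th consecutive interval.  The `s`-th
number gives the odd edge `2 s - 1` and the even edge `2 s`, and likewise the vertices `2 s - 1`
and `2 s`.  Both are written as elements of `Idx p ⊕ Idx p`: `inl s` is number `2 s - 1` and
`inr s` is number `2 s`. -/

/-- The elements `1, …, p₁ + ⋯ + p_k`, grouped into the `k` circles. -/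
abbrev Idx {k : ℕ} (p : Fin k → ℕ) : Type := Σ i : Fin k, Fin (p i)

/-- The cyclic successor within a circle. -/
def next {k : ℕ} {p : Fin k → ℕ} (s : Idx p) : Idx p := ⟨s.1, finRotate (p s.1) s.2⟩

/-- Edges of the `k` circles with `2 p₁, …, 2 p_k` edges. -/
abbrev Edge {k : ℕ} (p : Fin k → ℕ) : Type := Idx p ⊕ Idx p

/-- Vertices of the `k` circles. -/
abbrev Vertex {k : ℕ} (p : Fin k → ℕ) : Type := Idx p ⊕ Idx p

/-- The first vertex of an edge: edge `e` starts at vertex `e`. -/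
def edgeStart {k : ℕ} {p : Fin k → ℕ} (e : Edge p) : Vertex p := e

/-- The last vertex of an edge: edge `e` ends at vertex `e + 1`, cyclically on its circle. -/
def edgeEnd {k : ℕ} {p : Fin k → ℕ} : Edge p → Vertex p
  | .inl s => .inr s
  | .inr s => .inl (next s)

/-- The partial permutations of `p₁ + ⋯ + p_k` elements: injective maps `q : ρ₁ → ρ₂` onto `ρ₂`
between two subsets.  `j ∈ π i` means that `i ∈ ρ₁` and `q i = j`. -/
abbrev SP {k : ℕ} (p : Fin k → ℕ) : Type := Idx p ≃. Idx p

noncomputable instance {k : ℕ} (p : Fin k → ℕ) : Fintype (SP p) :=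
  @Fintype.ofFinite _ (Finite.of_injective (fun π : SP p => (π : Idx p → Option (Idx p)))
    DFunLike.coe_injective)

section PartialPermutation

variable {k : ℕ} {p : Fin k → ℕ} (π : SP p)

/-- The cardinality `|ρ₁|` of the domain of `π`. -/
noncomputable def domCard : ℕ := Nat.card {i : Idx p // (π i).isSome}

/-- The identifications of vertices that come from identifying, for `q i = j`, the even edge
`2 i` with the odd edge `2 j - 1` with opposite orientation. -/
inductive Glue : Vertex p → Vertex p → Prop
  | start_end (i j : Idx p) (h : j ∈ π i) : Glue (edgeStart (.inr i)) (edgeEnd (.inl j))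
  | end_start (i j : Idx p) (h : j ∈ π i) : Glue (edgeEnd (.inr i)) (edgeStart (.inl j))

/-- The partition `ρ(π)` of the vertices: the equivalence relation generated by the
identifications. -/
def vertexSetoid : Setoid (Vertex p) := Relation.EqvGen.setoid (Glue π)

/-- The blocks of `ρ(π)`. -/
abbrev VertexBlock : Type := Quotient (vertexSetoid π)

/-- The block of a vertex. -/
def vertexBlock (v : Vertex p) : VertexBlock π := Quotient.mk (vertexSetoid π) v

/-- Deterministic edges: even edges not from `ρ₁` and odd edges not from `ρ₂`. -/
def IsDet : Edge p → Prop
  | .inl s => ∀ i, s ∉ π i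
  | .inr s => ∀ j, j ∉ π s

/-- After the identification, the edge `e` borders to the vertex `b`. -/
def Borders (e : Edge p) (b : VertexBlock π) : Prop :=
  vertexBlock π (edgeStart e) = b ∨ vertexBlock π (edgeEnd e) = b

/-- The block `b` consists of even vertices only. -/
def IsEvenBlock (b : VertexBlock π) : Prop :=
  ∀ v : Vertex p, vertexBlock π v = b → v.isRight

/-- The block `b` consists of odd vertices only. -/
def IsOddBlock (b : VertexBlock π) : Prop :=
  ∀ v : Vertex p, vertexBlock π v = b → v.isLeft

/-- `k(ρ(π))`: the number of even blocks. -/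
noncomputable def kEven : ℕ := Nat.card {b : VertexBlock π // IsEvenBlock π b}

/-- `kd(ρ(π))`: the number of even blocks bordering to a deterministic edge. -/
noncomputable def kdEven : ℕ :=
  Nat.card {b : VertexBlock π // IsEvenBlock π b ∧ ∃ e, IsDet π e ∧ Borders π e b}

/-- `l(ρ(π))`: the number of odd blocks. -/
noncomputable def lOdd : ℕ := Nat.card {b : VertexBlock π // IsOddBlock π b}

/-- `ld(ρ(π))`: the number of odd blocks bordering to a deterministic edge. -/
noncomputable def ldOdd : ℕ :=
  Nat.card {b : VertexBlock π // IsOddBlock π b ∧ ∃ e, IsDet π e ∧ Borders π e b}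

/-- The type of deterministic edges. -/
abbrev DetEdge : Type := {e : Edge p // IsDet π e}

/-- The partition `σ(π)` of the deterministic edges into connected components: generated by
relating deterministic edges that share a vertex after the identification. -/
def detSetoid : Setoid (DetEdge π) :=
  Relation.EqvGen.setoid fun e f => ∃ b, Borders π e.1 b ∧ Borders π f.1 b

/-- The blocks of `σ(π)`. -/
abbrev DetBlock : Type := Quotient (detSetoid π)

/-- `|σ(π)|`: the number of blocks of `σ(π)`. -/
noncomputable def sigmaCard : ℕ := Nat.card (DetBlock π)

/-- Half of the (even) number of edges in a block of `σ(π)`. -/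
noncomputable def blockLen (c : DetBlock π) : ℕ :=
  Nat.card {e : DetEdge π // Quotient.mk (detSetoid π) e = c} / 2

end PartialPermutation

/-! ### The estimators -/

/-- The signed sum over partial permutations
`∑_π (-1)^|ρ₁| n^(|σ(π)| - k) / N^|ρ₁| · N^(k(ρ(π)) - kd(ρ(π))) n^(l(ρ(π)) - ld(ρ(π))) ·
Y_{l₁, …, l_r}`, with `Y_{l₁, …, l_r} = Y l₁ ⋯ Y l_r` (which is `1` if `r = 0`), where
`l₁, …, l_r` are the cardinalities of the blocks of `σ(π)` divided by `2`.  (The product over the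
finitely many blocks is written `∏ᶠ`.) -/
noncomputable def signedSum (n N : ℕ) {k : ℕ} (p : Fin k → ℕ) (Y : ℕ → ℂ) : ℂ :=
  ∑ π : SP p, (-1 : ℂ) ^ domCard π *
    ((n : ℂ) ^ ((sigmaCard π : ℤ) - (k : ℤ)) / (N : ℂ) ^ domCard π) *
    ((N : ℂ) ^ ((kEven π : ℤ) - (kdEven π : ℤ)) * (n : ℂ) ^ ((lOdd π : ℤ) - (ldOdd π : ℤ))) *
    ∏ᶠ c : DetBlock π, Y (blockLen π c)

/-- The estimator of `D_{p₁, …, p_k}` from one `n × N` observation `Y`. -/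
noncomputable def estimator {n N k : ℕ} (p : Fin k → ℕ) (Y : Matrix (Fin n) (Fin N) ℂ) : ℂ :=
  signedSum n N p (covMoment Y)

/-- The `L₁ × L₂` block matrix formed from `L₁ L₂` observations, placed in the order `e`. -/
def compound {n N L₁ L₂ : ℕ} (e : Fin L₁ × Fin L₂ ≃ Fin (L₁ * L₂))
    (Y : Fin (L₁ * L₂) → Matrix (Fin n) (Fin N) ℂ) :
    Matrix (Fin L₁ × Fin n) (Fin L₂ × Fin N) ℂ :=
  Matrix.of fun a b => Y (e (a.1, b.1)) a.2 b.2

/-- The estimator of `D_{p₁, …, p_k}` from an `(n L₁) × (N L₂)` compound observation matrix. -/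
noncomputable def compoundEstimator {n N L₁ L₂ k : ℕ} (p : Fin k → ℕ)
    (Z : Matrix (Fin L₁ × Fin n) (Fin L₂ × Fin N) ℂ) : ℂ :=
  (L₁ : ℂ) ^ ((k : ℤ) - ∑ i, (p i : ℤ)) * signedSum (n * L₁) (N * L₂) p (covMoment Z)

end GaussEst

set_option linter.unusedSectionVars false

namespace GaussEst

/-! Label the odd vertices by rows and the even vertices by columns. A product of traces of powers
of `Y * Yᴴ` is then the sum, over all labelings, of an entry of `Y` for each odd edge and a
conjugated entry for each even edge.

Fix the labels. Gaussian integration by parts (`integral_mono_succ`) gives a recursion for the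
expected product (`wick_insert`): an odd edge is either replaced by its mean or contracted with an
even edge that carries the same entry. The signed sum over partial permutations undoes this
(`sum_signedWeight_mul`). By induction on the allowed targets, the permutations that use a new
target `b` cancel exactly the contractions of `b` coming from those that do not, so only the means,
the entries of `D`, survive.

It remains to sum over the labels for fixed `π` (`sum_labelings`). Gluing is a partial injection on
vertices, so each block is a directed chain or a closed cycle. A chain runs from an end of a
deterministic odd edge to an end of a deterministic even edge, while a closed cycle meets no
deterministic edge. Closed cycles are free labels and give the powers of `n` and `N`. Chains join
the deterministic edges into circles, and each circle gives the trace of a power of `Y * Yᴴ`.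

The compound matrix is again a Gaussian model, with mean the block matrix of copies of `D`. The
`r`-th moment of this mean is `L₁ ^ (r - 1)` times that of `D`, which the prefactor of the compound
estimator corrects. -/

/-! ### Gaussian integration by parts and moments of a shifted complex Gaussian -/

open Polynomial in
theorem integrable_eval_gaussianReal (v : NNReal) (P : ℂ[X]) :
    Integrable (fun x : ℝ => P.eval (x : ℂ)) (gaussianReal 0 v) := by
  have h : ∀ k : ℕ, Integrable (fun x : ℝ => (x : ℂ) ^ k) (gaussianReal 0 v) := by
    intro k
    have h1 : Integrable (fun x : ℝ => ‖x‖ ^ k) (gaussianReal 0 v) :=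
      (memLp_id_gaussianReal (μ := 0) (v := v) k).integrable_norm_pow'
    refine h1.mono' (by fun_prop) (ae_of_all _ fun x => ?_)
    simp
  simp_rw [Polynomial.eval_eq_sum_range]
  exact integrable_finsetSum _ fun k _ => (h k).const_mul _

theorem hasDerivAt_gaussianPDFReal (v : NNReal) (x : ℝ) :
    HasDerivAt (gaussianPDFReal 0 v) (-(x / v) * gaussianPDFReal 0 v x) x := by
  have h1 : HasDerivAt (fun y : ℝ => -(y - 0) ^ 2 / (2 * v)) (-(x / v)) x := by
    have h2 := (((hasDerivAt_id x).sub_const 0).pow 2).neg.div_const (2 * (v : ℝ))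
    convert! h2 using 1
    -- For `v = 0` every quotient is `0` by the convention on division.
    by_cases hv : (v : ℝ) = 0
    · simp [hv]
    · simp
      field_simp
  have h3 := (h1.exp).const_mul ((√(2 * Real.pi * v))⁻¹)
  rw [gaussianPDFReal_def]
  convert! h3 using 1
  ring

open Polynomial in
/-- Gaussian integration by parts for polynomials. -/
theorem integral_mul_eval_gaussianReal {v : NNReal} (hv : v ≠ 0) (P : ℂ[X]) :
    ∫ x : ℝ, (x : ℂ) * P.eval (x : ℂ) ∂(gaussianReal 0 v) =
      (v : ℂ) * ∫ x : ℝ, P.derivative.eval (x : ℂ) ∂(gaussianReal 0 v) := by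
  have hI : ∀ Q : ℂ[X], Integrable (fun x : ℝ => Q.eval (x : ℂ) * (gaussianPDFReal 0 v x : ℂ)) := by
    intro Q
    have h := integrable_eval_gaussianReal v Q
    rw [gaussianReal_of_var_ne_zero _ hv, integrable_withDensity_iff_integrable_smul'
      (measurable_gaussianPDF 0 v) (ae_of_all _ fun x => gaussianPDF_lt_top)] at h
    refine h.congr (ae_of_all _ fun x => ?_)
    simp only [toReal_gaussianPDF, Complex.real_smul]
    ring
  have hv' : (v : ℂ) ≠ 0 := by exact_mod_cast hv
  have hX : ∀ x : ℝ, P.eval (x : ℂ) * ((-(x / v) * gaussianPDFReal 0 v x : ℝ) : ℂ) =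
      (C (-(v : ℂ)⁻¹) * X * P).eval (x : ℂ) * (gaussianPDFReal 0 v x : ℂ) := by
    intro x
    push_cast
    simp only [eval_mul, eval_C, eval_X]
    ring
  -- No boundary terms appear: the density times any polynomial is integrable, and its derivative is
  -- `-x / v` times itself.
  have key := integral_mul_deriv_eq_deriv_mul_of_integrable
    (u := fun x : ℝ => P.eval (x : ℂ)) (v := fun x : ℝ => (gaussianPDFReal 0 v x : ℂ))
    (u' := fun x : ℝ => P.derivative.eval (x : ℂ))
    (v' := fun x : ℝ => ((-(x / v) * gaussianPDFReal 0 v x : ℝ) : ℂ))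
    (fun x _ => (P.hasDerivAt (x : ℂ)).comp_ofReal)
    (fun x _ => (hasDerivAt_gaussianPDFReal v x).ofReal_comp)
    ((hI _).congr (ae_of_all _ fun x => (hX x).symm)) (hI _) (hI _)
  simp_rw [integral_gaussianReal_eq_integral_smul hv, Complex.real_smul]
  have e1 : ∫ x : ℝ, (gaussianPDFReal 0 v x : ℂ) * ((x : ℂ) * P.eval (x : ℂ)) =
      -(v : ℂ) * ∫ x : ℝ, P.eval (x : ℂ) * ((-(x / v) * gaussianPDFReal 0 v x : ℝ) : ℂ) := by
    rw [← integral_const_mul]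
    congr 1 with x
    push_cast
    field_simp
  rw [e1, key]
  simp only [neg_mul_neg]
  congr 2 with x
  ring

theorem measurable_complex_mk : Measurable (fun x : ℝ × ℝ => (⟨x.1, x.2⟩ : ℂ)) :=
  Complex.measurableEquivRealProd.symm.measurable

instance : IsProbabilityMeasure stdComplexGaussian :=
  Measure.isProbabilityMeasure_map measurable_complex_mk.aemeasurable

theorem memLp_id_stdComplexGaussian (r : NNReal) : MemLp id r stdComplexGaussian := by
  rw [stdComplexGaussian, memLp_map_measure_iff (by fun_prop) measurable_complex_mk.aemeasurable]
  have h := memLp_id_gaussianReal (μ := 0) (v := 1 / 2) r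
  have h1 := (h.comp_fst (gaussianReal 0 (1 / 2))).ofReal (K := ℂ)
  have h2 := ((h.comp_snd (gaussianReal 0 (1 / 2))).ofReal (K := ℂ)).const_mul Complex.I
  refine (h1.add h2).congr_norm (measurable_complex_mk.aestronglyMeasurable)
    (ae_of_all _ fun x => ?_)
  congr 1
  apply Complex.ext <;> simp

theorem memLp_conj {Ω : Type*} [MeasurableSpace Ω] {μ : Measure Ω} {f : Ω → ℂ} {r : ENNReal}
    (hf : MemLp f r μ) : MemLp (fun ω => (starRingEnd ℂ) (f ω)) r μ :=
  hf.congr_norm (Complex.continuous_conj.comp_aestronglyMeasurable hf.1)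
    (ae_of_all _ fun x => by simp)

/-- A finite product of functions with all moments is integrable. -/
theorem integrable_prod_of_memLp {Ω ι : Type*} [MeasurableSpace Ω] {μ : Measure Ω}
    [IsProbabilityMeasure μ] (s : Finset ι) (f : ι → Ω → ℂ)
    (hf : ∀ i ∈ s, ∀ r : NNReal, MemLp (f i) r μ) :
    Integrable (fun ω => ∏ i ∈ s, f i ω) μ := by
  rcases s.eq_empty_or_nonempty with rfl | hs
  · simp
  -- Hölder with all exponents equal to the number of factors, so that the reciprocals add up to
  -- `1`.
  have h := MemLp.prod' (s := s) (f := f) (p := fun _ => ((s.card : NNReal) : ENNReal)) (μ := μ)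
    (fun i hi => hf i hi _)
  rw [← memLp_one_iff_integrable]
  convert h using 1
  have : (s.card : ENNReal) ≠ 0 := by simpa using hs.ne_empty
  simp [ENNReal.mul_inv_cancel this]

/-- The monomials `Y ^ a * conj Y ^ b`. -/
noncomputable def mono (d : ℂ) (a b : ℕ) (z : ℂ) : ℂ :=
  (d + z) ^ a * (starRingEnd ℂ (d + z)) ^ b

theorem integrable_mono (d : ℂ) (a b : ℕ) : Integrable (mono d a b) stdComplexGaussian := by
  have h : ∀ r : NNReal, MemLp (fun z => d + z) r stdComplexGaussian := fun r =>
    (memLp_const d).add (memLp_id_stdComplexGaussian r)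
  have := integrable_prod_of_memLp (μ := stdComplexGaussian) (Finset.univ : Finset (Fin a ⊕ Fin b))
    (fun i z => Sum.elim (fun _ => d + z) (fun _ => starRingEnd ℂ (d + z)) i)
    (by rintro (i | i) - r
        · exact h r
        · exact memLp_conj (h r))
  refine this.congr (ae_of_all _ fun z => ?_)
  simp [mono]

theorem integral_stdComplexGaussian (f : ℂ → ℂ) (hf : AEStronglyMeasurable f stdComplexGaussian) :
    ∫ z, f z ∂stdComplexGaussian =
      ∫ x : ℝ × ℝ, f ⟨x.1, x.2⟩ ∂((gaussianReal 0 (1 / 2)).prod (gaussianReal 0 (1 / 2))) := by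
  rw [stdComplexGaussian] at hf ⊢
  rw [integral_map measurable_complex_mk.aemeasurable hf]

theorem integrable_stdComplexGaussian {f : ℂ → ℂ} (hf : Integrable f stdComplexGaussian) :
    Integrable (fun x : ℝ × ℝ => f ⟨x.1, x.2⟩)
      ((gaussianReal 0 (1 / 2)).prod (gaussianReal 0 (1 / 2))) := by
  rw [stdComplexGaussian] at hf
  exact hf.comp_measurable measurable_complex_mk

theorem continuous_mono (d : ℂ) (a b : ℕ) : Continuous (mono d a b) := by
  unfold mono
  exact ((continuous_const.add continuous_id).pow a).mul
    ((Complex.continuous_conj.comp (continuous_const.add continuous_id)).pow b)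

theorem id_mul_mono (d : ℂ) (a b : ℕ) (z : ℂ) :
    z * mono d a b z = mono d (a + 1) b z - d * mono d a b z := by
  simp only [mono]; ring

theorem integrable_id_mul_mono (d : ℂ) (a b : ℕ) :
    Integrable (fun z => z * mono d a b z) stdComplexGaussian := by
  simp_rw [id_mul_mono]
  exact (integrable_mono d (a + 1) b).sub ((integrable_mono d a b).const_mul d)

theorem integrable_re_mul_mono (d : ℂ) (a b : ℕ) :
    Integrable (fun z => (z.re : ℂ) * mono d a b z) stdComplexGaussian := by
  refine (integrable_id_mul_mono d a b).mono
    ((Complex.continuous_ofReal.comp Complex.continuous_re).mul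
      (continuous_mono d a b)).aestronglyMeasurable (ae_of_all _ fun z => ?_)
  simp only [norm_mul, Complex.norm_real, Real.norm_eq_abs]
  exact mul_le_mul_of_nonneg_right (Complex.abs_re_le_norm z) (norm_nonneg _)

theorem integrable_im_mul_mono (d : ℂ) (a b : ℕ) :
    Integrable (fun z => (z.im : ℂ) * mono d a b z) stdComplexGaussian := by
  refine (integrable_id_mul_mono d a b).mono
    ((Complex.continuous_ofReal.comp Complex.continuous_im).mul
      (continuous_mono d a b)).aestronglyMeasurable (ae_of_all _ fun z => ?_)
  simp only [norm_mul, Complex.norm_real, Real.norm_eq_abs]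
  exact mul_le_mul_of_nonneg_right (Complex.abs_im_le_norm z) (norm_nonneg _)

theorem integrable_mono_add_mono (c d c' : ℂ) (a b a' b' : ℕ) :
    Integrable (fun z => c * mono d a b z + c' * mono d a' b' z) stdComplexGaussian :=
  ((integrable_mono _ _ _).const_mul _).add ((integrable_mono _ _ _).const_mul _)

open Polynomial in
-- With the imaginary part frozen the monomial is a polynomial in the real part, and real
-- integration by parts applies; `1 / 2` is the variance. The truncated `a - 1` and `b - 1` are
-- harmless, since their coefficients vanish at `0`.
theorem integral_re_mul_mono (d : ℂ) (a b : ℕ) :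
    ∫ z, (z.re : ℂ) * mono d a b z ∂stdComplexGaussian =
      1 / 2 * (a * ∫ z, mono d (a - 1) b z ∂stdComplexGaussian +
        b * ∫ z, mono d a (b - 1) z ∂stdComplexGaussian) := by
  rw [← integral_const_mul, ← integral_const_mul, ← integral_add
    ((integrable_mono _ _ _).const_mul _) ((integrable_mono _ _ _).const_mul _),
    integral_stdComplexGaussian _ (integrable_re_mul_mono d a b).1,
    integral_stdComplexGaussian _ (integrable_mono_add_mono _ _ _ _ _ _ _).1,
    integral_prod_symm _ (integrable_stdComplexGaussian (integrable_re_mul_mono d a b)),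
    integral_prod_symm _ (integrable_stdComplexGaussian (integrable_mono_add_mono _ _ _ _ _ _ _)), ← integral_const_mul]
  congr 1 with y
  set P : ℂ[X] := (C (d + y * Complex.I) + X) ^ a *
    (C ((starRingEnd ℂ) d - y * Complex.I) + X) ^ b with hP
  have key := integral_mul_eval_gaussianReal (v := 1 / 2) (by simp) P
  have e1 : ∀ x : ℝ, P.eval (x : ℂ) = mono d a b ⟨x, y⟩ := by
    intro x
    simp only [hP, mono, eval_mul, eval_pow, eval_add, eval_C, eval_X, Complex.mk_eq_add_mul_I,
      map_add, map_mul, Complex.conj_ofReal, Complex.conj_I]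
    congr 2 <;> ring
  have e2 : ∀ x : ℝ, P.derivative.eval (x : ℂ) =
      a * mono d (a - 1) b ⟨x, y⟩ + b * mono d a (b - 1) ⟨x, y⟩ := by
    intro x
    simp only [hP, mono, derivative_mul, derivative_pow, derivative_C,
      derivative_X, eval_mul, eval_pow, eval_add, eval_C, eval_X, Complex.mk_eq_add_mul_I,
      map_add, map_mul, Complex.conj_ofReal, Complex.conj_I, map_natCast, eval_natCast, eval_one,
      eval_zero, zero_add, mul_one]
    rw [show d + y * Complex.I + (x : ℂ) = d + (x + y * Complex.I) by ring,
      show (starRingEnd ℂ) d - y * Complex.I + (x : ℂ) =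
        (starRingEnd ℂ) d + (x + y * -Complex.I) by ring]
    ring
  simp_rw [e1, e2] at key
  simpa using key

open Polynomial in
-- Now the real part is frozen. Differentiation in the imaginary part brings out `I` from the plain
-- factor and `-I` from the conjugated one.
theorem integral_im_mul_mono (d : ℂ) (a b : ℕ) :
    ∫ z, (z.im : ℂ) * mono d a b z ∂stdComplexGaussian =
      1 / 2 * (Complex.I * a * ∫ z, mono d (a - 1) b z ∂stdComplexGaussian +
        -Complex.I * b * ∫ z, mono d a (b - 1) z ∂stdComplexGaussian) := by
  rw [← integral_const_mul, ← integral_const_mul, ← integral_add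
    ((integrable_mono _ _ _).const_mul _) ((integrable_mono _ _ _).const_mul _),
    integral_stdComplexGaussian _ (integrable_im_mul_mono d a b).1,
    integral_stdComplexGaussian _ (integrable_mono_add_mono _ _ _ _ _ _ _).1,
    integral_prod _ (integrable_stdComplexGaussian (integrable_im_mul_mono d a b)),
    integral_prod _ (integrable_stdComplexGaussian (integrable_mono_add_mono _ _ _ _ _ _ _)), ← integral_const_mul]
  congr 1 with x
  set P : ℂ[X] := (C (d + x) + C Complex.I * X) ^ a *
    (C ((starRingEnd ℂ) d + x) + C (-Complex.I) * X) ^ b with hP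
  have key := integral_mul_eval_gaussianReal (v := 1 / 2) (by simp) P
  have e1 : ∀ y : ℝ, P.eval (y : ℂ) = mono d a b ⟨x, y⟩ := by
    intro y
    simp only [hP, mono, eval_mul, eval_pow, eval_add, eval_C, eval_X, Complex.mk_eq_add_mul_I,
      map_add, map_mul, Complex.conj_ofReal, Complex.conj_I]
    congr 2 <;> ring
  have e2 : ∀ y : ℝ, P.derivative.eval (y : ℂ) =
      Complex.I * a * mono d (a - 1) b ⟨x, y⟩ + -Complex.I * b * mono d a (b - 1) ⟨x, y⟩ := by
    intro y
    simp only [hP, mono, derivative_mul, derivative_pow, derivative_C,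
      derivative_X, eval_mul, eval_pow, eval_add, eval_C, eval_X, Complex.mk_eq_add_mul_I,
      map_add, map_mul, Complex.conj_ofReal, Complex.conj_I, map_natCast, eval_natCast,
      zero_add, zero_mul, mul_one]
    rw [show d + x + Complex.I * (y : ℂ) = d + (x + y * Complex.I) by ring,
      show (starRingEnd ℂ) d + x + -Complex.I * (y : ℂ) =
        (starRingEnd ℂ) d + (x + y * -Complex.I) by ring]
    ring
  simp_rw [e1, e2] at key
  simpa using key

/-- Recursion for the mixed moments of a shifted complex Gaussian. -/
theorem integral_mono_succ (d : ℂ) (a b : ℕ) :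
    ∫ z, mono d (a + 1) b z ∂stdComplexGaussian =
      d * ∫ z, mono d a b z ∂stdComplexGaussian +
        b * ∫ z, mono d a (b - 1) z ∂stdComplexGaussian := by
  have h : ∀ z, mono d (a + 1) b z = d * mono d a b z + ((z.re : ℂ) * mono d a b z +
      Complex.I * ((z.im : ℂ) * mono d a b z)) := by
    intro z
    have h1 := id_mul_mono d a b z
    have h2 := Complex.re_add_im z
    linear_combination -h1 - mono d a b z * h2
  simp_rw [h]
  have i1 := (integrable_mono d a b).const_mul d
  have i2 := integrable_re_mul_mono d a b
  have i3 := (integrable_im_mul_mono d a b).const_mul Complex.I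
  have i23 : Integrable (fun z => (z.re : ℂ) * mono d a b z +
      Complex.I * ((z.im : ℂ) * mono d a b z)) stdComplexGaussian := i2.add i3
  rw [integral_add i1 i23, integral_add i2 i3, integral_const_mul, integral_const_mul,
    integral_re_mul_mono, integral_im_mul_mono]
  -- Since `I * I = -1`, the two terms in `a` cancel and the two halves in `b` add up: `z` contracts
  -- only with its conjugate.
  linear_combination (1 / 2 * (a * ∫ z, mono d (a - 1) b z ∂stdComplexGaussian) -
    1 / 2 * (b * ∫ z, mono d a (b - 1) z ∂stdComplexGaussian)) * Complex.I_mul_I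

theorem integral_mono_right_zero (d : ℂ) (a : ℕ) :
    ∫ z, mono d a 0 z ∂stdComplexGaussian = d ^ a := by
  induction a with
  | zero => simp [mono]
  | succ a ih => rw [integral_mono_succ, ih]; simp; ring

theorem integral_mono_left_zero (d : ℂ) (b : ℕ) :
    ∫ z, mono d 0 b z ∂stdComplexGaussian = (starRingEnd ℂ d) ^ b := by
  rw [← map_pow, ← integral_mono_right_zero, ← integral_conj]
  simp [mono]

/-! ### Signed sums over partial permutations -/

section PartialMatchings

variable {I : Type*} [Fintype I] [DecidableEq I]

/-- The domain of a partial permutation, as a finset. -/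
def domFinset (π : I ≃. I) : Finset I := Finset.univ.filter fun i => (π i).isSome

theorem mem_domFinset {π : I ≃. I} {i : I} : i ∈ domFinset π ↔ ∃ j, j ∈ π i := by
  simp only [domFinset, Finset.mem_filter, Finset.mem_univ, true_and, Option.isSome_iff_exists,
    Option.mem_def]

theorem mem_domFinset_symm {π : I ≃. I} {j : I} : j ∈ domFinset π.symm ↔ ∃ i, j ∈ π i := by
  simp only [mem_domFinset, PEquiv.mem_iff_mem]

/-- Add the pair `(a, b)` to a partial permutation. -/
def insertPair (π : I ≃. I) (a b : I) (ha : a ∉ domFinset π) (hb : b ∉ domFinset π.symm) :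
    I ≃. I where
  toFun := Function.update π a (some b)
  invFun := Function.update π.symm b (some a)
  inv i j := by
    rw [mem_domFinset] at ha
    rw [mem_domFinset_symm] at hb
    push Not at ha hb
    have h := PEquiv.mem_iff_mem (f := π) (a := i) (b := j)
    rcases eq_or_ne i a with rfl | hi <;> rcases eq_or_ne j b with rfl | hj
    · simp
    · simp only [Function.update_self, Function.update_of_ne hj]
      exact iff_of_false (fun h1 => ha j (h.1 h1)) (by simpa using hj.symm)
    · simp only [Function.update_self, Function.update_of_ne hi]
      exact iff_of_false (by simpa using hi.symm) (fun h1 => hb i h1)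
    · simp only [Function.update_of_ne hi, Function.update_of_ne hj]
      exact h

/-- Remove the pair `(a, b)` from a partial permutation. -/
def erasePair (π : I ≃. I) (a b : I) (hab : b ∈ π a) : I ≃. I where
  toFun := Function.update π a none
  invFun := Function.update π.symm b none
  inv i j := by
    have h := PEquiv.mem_iff_mem (f := π) (a := i) (b := j)
    rcases eq_or_ne i a with rfl | hi <;> rcases eq_or_ne j b with rfl | hj
    · simp
    · simp only [Function.update_self, Function.update_of_ne hj]
      exact iff_of_false (fun h1 => hj (Option.mem_unique (h.1 h1) hab)) (by simp)
    · simp only [Function.update_self, Function.update_of_ne hi]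
      exact iff_of_false (by simp) (fun h1 => hi (π.inj h1 hab))
    · simp only [Function.update_of_ne hi, Function.update_of_ne hj]
      exact h

theorem insertPair_apply (π : I ≃. I) (a b : I) (ha hb) (i : I) :
    insertPair π a b ha hb i = if i = a then some b else π i := by
  change Function.update π a (some b) i = _
  rw [Function.update_apply]

theorem erasePair_apply (π : I ≃. I) (a b : I) (hab) (i : I) :
    erasePair π a b hab i = if i = a then none else π i := by
  change Function.update π a none i = _
  rw [Function.update_apply]

theorem mem_insertPair {π : I ≃. I} {a b : I} {ha hb} {i j : I} :
    j ∈ insertPair π a b ha hb i ↔ (i = a ∧ j = b) ∨ j ∈ π i := by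
  rw [insertPair_apply]
  rw [mem_domFinset] at ha
  push Not at ha
  split_ifs with h
  · subst h
    simp [ha, eq_comm]
  · simp [h]

theorem mem_erasePair {π : I ≃. I} {a b : I} {hab} {i j : I} :
    j ∈ erasePair π a b hab i ↔ i ≠ a ∧ j ∈ π i := by
  rw [erasePair_apply]
  split_ifs with h <;> simp [h]

theorem domFinset_insertPair (π : I ≃. I) (a b : I) (ha hb) :
    domFinset (insertPair π a b ha hb) = insert a (domFinset π) := by
  ext i
  simp only [mem_domFinset, mem_insertPair, exists_or, Finset.mem_insert, exists_and_left,
    exists_eq, and_true]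

theorem domFinset_insertPair_symm (π : I ≃. I) (a b : I) (ha hb) :
    domFinset (insertPair π a b ha hb).symm = insert b (domFinset π.symm) := by
  ext i
  simp only [mem_domFinset_symm, mem_insertPair, exists_or, Finset.mem_insert,
    exists_and_right, exists_eq, true_and]

theorem prod_insertPair (c : I → I → ℂ) (π : I ≃. I) (a b : I) (ha hb) :
    ∏ i, (insertPair π a b ha hb i).elim 1 (c i) = c a b * ∏ i, (π i).elim 1 (c i) := by
  have h : ∀ i, (insertPair π a b ha hb i).elim 1 (c i) =
      (if i = a then c a b else 1) * (π i).elim 1 (c i) := by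
    intro i
    rw [insertPair_apply]
    split_ifs with h
    · subst h
      have : π i = none := by simpa [domFinset] using ha
      simp [this]
    · simp
  rw [Finset.prod_congr rfl fun i _ => h i, Finset.prod_mul_distrib]
  simp

/-- The signed weight of a partial permutation. -/
def signedWeight (c : I → I → ℂ) (π : I ≃. I) : ℂ :=
  (-1) ^ (domFinset π).card * ∏ i, (π i).elim 1 (c i)

theorem signedWeight_insertPair (c : I → I → ℂ) (π : I ≃. I) (a b : I) (ha hb) :
    signedWeight c (insertPair π a b ha hb) = -(c a b * signedWeight c π) := by
  rw [signedWeight, signedWeight, domFinset_insertPair, prod_insertPair,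
    Finset.card_insert_of_notMem ha, pow_succ]
  ring

variable [Fintype (I ≃. I)]

/-- If `F` satisfies the Wick recursion, then the signed sum over all partial permutations with
range in `A` recovers the product of the means. -/
theorem sum_signedWeight_mul_of_range_subset (c : I → I → ℂ) (u : I → ℂ)
    (F : Finset I → Finset I → ℂ)
    (hF : ∀ A B b, b ∉ A → F (insert b A) B = u b * F A B + ∑ i ∈ B, c i b * F A (B.erase i))
    (A : Finset I) :
    ∑ π : I ≃. I with domFinset π.symm ⊆ A,
      signedWeight c π * F (A \ domFinset π.symm) (domFinset π)ᶜ =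
    (∏ j ∈ A, u j) * F ∅ Finset.univ := by
  classical
  induction A using Finset.induction_on with
  | empty =>
    rw [Finset.sum_eq_single (⊥ : I ≃. I)]
    · have h1 : domFinset (⊥ : I ≃. I) = ∅ := by ext; simp [mem_domFinset]
      simp [signedWeight, h1]
    · intro π hπ hne
      refine absurd ?_ hne
      simp only [Finset.mem_filter, Finset.mem_univ, true_and, Finset.subset_empty] at hπ
      ext i j
      have : j ∉ domFinset π.symm := by simp [hπ]
      rw [mem_domFinset_symm] at this
      push Not at this
      exact iff_of_false (this i) (by simp)
    · intro h
      refine absurd ?_ h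
      simp only [Finset.mem_filter, Finset.mem_univ, true_and, Finset.subset_empty]
      ext; simp [mem_domFinset]
  | insert b A hb ih =>
    -- Split according to whether the new element `b` lies in the range of `π`.
    rw [Finset.prod_insert hb, mul_assoc, ← ih, ← Finset.sum_filter_add_sum_filter_not
      _ (fun π : I ≃. I => b ∉ domFinset π.symm), Finset.filter_filter, Finset.filter_filter]
    have e1 : (Finset.univ.filter fun π : I ≃. I =>
        domFinset π.symm ⊆ insert b A ∧ b ∉ domFinset π.symm) =
        Finset.univ.filter fun π : I ≃. I => domFinset π.symm ⊆ A := by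
      ext π
      simp only [Finset.mem_filter, Finset.mem_univ, true_and]
      exact ⟨fun h => (Finset.subset_insert_iff_of_notMem h.2).1 h.1,
        fun h => ⟨h.trans (Finset.subset_insert _ _), fun h' => hb (h h')⟩⟩
    -- If `b` is not in the range, it is still an uncontracted factor, and the recursion removes it.
    have e2 : ∑ π : I ≃. I with domFinset π.symm ⊆ A,
        signedWeight c π * F (insert b A \ domFinset π.symm) (domFinset π)ᶜ =
        ∑ π : I ≃. I with domFinset π.symm ⊆ A,
          (u b * (signedWeight c π * F (A \ domFinset π.symm) (domFinset π)ᶜ) +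
          ∑ i ∈ (domFinset π)ᶜ, c i b * signedWeight c π *
            F (A \ domFinset π.symm) ((domFinset π)ᶜ.erase i)) := by
      refine Finset.sum_congr rfl fun π hπ => ?_
      simp only [Finset.mem_filter, Finset.mem_univ, true_and] at hπ
      rw [Finset.insert_sdiff_of_notMem _ (fun h => hb (hπ h)),
        hF _ _ _ (fun h => hb (Finset.mem_sdiff.1 h).1), mul_add, Finset.mul_sum]
      congr 1
      · ring
      · exact Finset.sum_congr rfl fun i _ => by ring
    -- If `b` is in the range, erasing its pair `(i, b)` leaves a permutation with range in `A` and
    -- a point `i` outside its domain. The sign flips, so these terms cancel the contractions of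
    -- `e2`.
    have e3 : ∑ π : I ≃. I with domFinset π.symm ⊆ insert b A ∧ ¬ b ∉ domFinset π.symm,
        signedWeight c π * F (insert b A \ domFinset π.symm) (domFinset π)ᶜ =
        ∑ π : I ≃. I with domFinset π.symm ⊆ A, ∑ i ∈ (domFinset π)ᶜ,
          -(c i b * signedWeight c π *
            F (A \ domFinset π.symm) ((domFinset π)ᶜ.erase i)) := by
      rw [Finset.sum_sigma']
      symm
      refine Finset.sum_bij (fun x hx => insertPair x.1 x.2 b ?_ ?_) ?_ ?_ ?_ ?_
      · simp only [Finset.mem_sigma, Finset.mem_compl] at hx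
        exact hx.2
      · simp only [Finset.mem_sigma, Finset.mem_filter] at hx
        exact fun h => hb (hx.1.2 h)
      · intro x hx
        simp only [Finset.mem_sigma, Finset.mem_filter, Finset.mem_univ, true_and] at hx
        simp only [Finset.mem_filter, Finset.mem_univ, true_and, domFinset_insertPair_symm]
        exact ⟨Finset.insert_subset_insert _ hx.1, by simp⟩
      · rintro ⟨π, i⟩ hx ⟨π', i'⟩ hx' h
        simp only [Finset.mem_sigma, Finset.mem_filter, Finset.mem_univ, true_and,
          Finset.mem_compl, mem_domFinset] at hx hx'
        have h1 : ∀ s t, ((s = i ∧ t = b) ∨ t ∈ π s) ↔ ((s = i' ∧ t = b) ∨ t ∈ π' s) := by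
          intro s t
          have := congrArg (fun ρ : I ≃. I => t ∈ ρ s) h
          simpa only [mem_insertPair, eq_iff_iff] using this
        have hb1 : ∀ s, b ∉ π s := fun s hs => hb (hx.1 (mem_domFinset_symm.2 ⟨s, hs⟩))
        have hb2 : ∀ s, b ∉ π' s := fun s hs => hb (hx'.1 (mem_domFinset_symm.2 ⟨s, hs⟩))
        have hi : i = i' := by
          have := (h1 i b).1 (Or.inl ⟨rfl, rfl⟩)
          rcases this with h | h
          · exact h.1
          · exact absurd h (hb2 _)
        subst hi
        have hπ : π = π' := by
          refine PEquiv.ext fun s => Option.ext fun t => ?_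
          by_cases ht : t = b
          · subst ht
            exact iff_of_false (hb1 s) (hb2 s)
          · simpa [ht] using h1 s t
        subst hπ
        rfl
      · intro ρ hρ
        simp only [Finset.mem_filter, Finset.mem_univ, true_and, not_not] at hρ
        obtain ⟨a, ha⟩ := mem_domFinset_symm.1 hρ.2
        have h1 : a ∉ domFinset (erasePair ρ a b ha) := by
          simp only [mem_domFinset, mem_erasePair, ne_eq, not_true_eq_false, false_and,
            exists_false, not_false_eq_true]
        have h2 : domFinset (erasePair ρ a b ha).symm ⊆ A := by
          intro j hj
          obtain ⟨i, hi⟩ := mem_domFinset_symm.1 hj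
          rw [mem_erasePair] at hi
          have := hρ.1 (mem_domFinset_symm.2 ⟨i, hi.2⟩)
          refine (Finset.mem_insert.1 this).resolve_left ?_
          rintro rfl
          exact hi.1 (ρ.inj hi.2 ha)
        refine ⟨⟨erasePair ρ a b ha, a⟩, by simp [h1, h2], ?_⟩
        refine PEquiv.ext fun s => ?_
        rw [insertPair_apply, erasePair_apply]
        split_ifs with hs
        · subst hs; exact ha.symm
        · rfl
      · rintro ⟨π, i⟩ hx
        simp only [Finset.mem_sigma, Finset.mem_filter, Finset.mem_univ, true_and] at hx
        rw [signedWeight_insertPair, domFinset_insertPair, domFinset_insertPair_symm,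
          Finset.insert_sdiff_insert, Finset.compl_insert, Finset.sdiff_insert_of_notMem hb]
        ring
    rw [e1, e2, e3, Finset.mul_sum, ← Finset.sum_add_distrib]
    refine Finset.sum_congr rfl fun π _ => ?_
    rw [Finset.sum_neg_distrib]
    ring

/-- If `F` satisfies the Wick recursion, then the signed sum over all partial permutations
recovers the product of the means. -/
theorem sum_signedWeight_mul (c : I → I → ℂ) (u : I → ℂ) (F : Finset I → Finset I → ℂ)
    (hF : ∀ A B b, b ∉ A → F (insert b A) B = u b * F A B + ∑ i ∈ B, c i b * F A (B.erase i)) :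
    ∑ π : I ≃. I, signedWeight c π * F (domFinset π.symm)ᶜ (domFinset π)ᶜ =
      (∏ j, u j) * F ∅ Finset.univ := by
  have := sum_signedWeight_mul_of_range_subset c u F hF Finset.univ
  simpa [Finset.compl_eq_univ_sdiff] using this

end PartialMatchings

/-! ### Wick recursion for products of entries -/

section Wick

variable {I L : Type*} [Fintype I] [DecidableEq I] [Fintype L] [DecidableEq L]

/-- The expectation of a product of entries `Y (α j)`, `j ∈ A`, and of conjugated entries
`conj (Y (β i))`, `i ∈ B`, where the `Y l` are independent shifted complex Gaussians. -/
noncomputable def wick (d : L → ℂ) (α β : I → L) (A B : Finset I) : ℂ :=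
  ∏ l, ∫ z, mono (d l) (A.filter fun j => α j = l).card (B.filter fun i => β i = l).card z
    ∂stdComplexGaussian

theorem wick_empty (d : L → ℂ) (α β : I → L) (B : Finset I) :
    wick d α β ∅ B = ∏ i ∈ B, starRingEnd ℂ (d (β i)) := by
  simp only [wick, Finset.filter_empty, Finset.card_empty, integral_mono_left_zero]
  rw [← Finset.prod_fiberwise_of_maps_to (s := B) (t := Finset.univ) (g := β) (by simp)]
  refine Finset.prod_congr rfl fun l _ => ?_
  rw [Finset.prod_congr rfl (g := fun _ => starRingEnd ℂ (d l)), Finset.prod_const]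
  intro i hi
  rw [(Finset.mem_filter.1 hi).2]

/-- Only the factor at `α b` changes, and `integral_mono_succ` applies to it. Its coefficient counts
the `i ∈ B` with `β i = α b`, and is spread out as a sum of indicators. -/
theorem wick_insert (d : L → ℂ) (α β : I → L) (A B : Finset I) (b : I) (hb : b ∉ A) :
    wick d α β (insert b A) B = d (α b) * wick d α β A B +
      ∑ i ∈ B, (if β i = α b then 1 else 0) * wick d α β A (B.erase i) := by
  have hsplit : ∀ A B, wick d α β A B =
      (∫ z, mono (d (α b)) (A.filter fun j => α j = α b).card
        (B.filter fun i => β i = α b).card z ∂stdComplexGaussian) *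
      ∏ l ∈ Finset.univ.erase (α b), ∫ z, mono (d l) (A.filter fun j => α j = l).card
        (B.filter fun i => β i = l).card z ∂stdComplexGaussian := fun A B =>
    (Finset.mul_prod_erase _ _ (Finset.mem_univ _)).symm
  have h1 : ∀ i ∈ B, (if β i = α b then 1 else 0) * wick d α β A (B.erase i) =
      (if β i = α b then 1 else 0) *
        ((∫ z, mono (d (α b)) (A.filter fun j => α j = α b).card
          ((B.filter fun i => β i = α b).card - 1) z ∂stdComplexGaussian) *
        ∏ l ∈ Finset.univ.erase (α b), ∫ z, mono (d l) (A.filter fun j => α j = l).card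
          (B.filter fun i => β i = l).card z ∂stdComplexGaussian) := by
    intro i hi
    split_ifs with h
    · rw [hsplit, Finset.filter_erase, Finset.card_erase_of_mem (by simp [hi, h])]
      congr 2
      refine Finset.prod_congr rfl fun l hl => ?_
      rw [Finset.filter_erase, Finset.erase_eq_of_notMem]
      simp only [Finset.mem_filter, not_and]
      rintro - rfl
      simp [h] at hl
    · simp
  rw [Finset.sum_congr rfl h1, ← Finset.sum_mul, Finset.sum_boole, hsplit, hsplit,
    Finset.filter_insert, if_pos rfl, Finset.card_insert_of_notMem (by simp [hb]),
    integral_mono_succ]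
  have h2 : ∀ l ∈ Finset.univ.erase (α b),
      ∫ z, mono (d l) ((insert b A).filter fun j => α j = l).card
        (B.filter fun i => β i = l).card z ∂stdComplexGaussian =
      ∫ z, mono (d l) (A.filter fun j => α j = l).card
        (B.filter fun i => β i = l).card z ∂stdComplexGaussian := by
    intro l hl
    rw [Finset.filter_insert, if_neg]
    rintro rfl
    simp at hl
  rw [Finset.prod_congr rfl h2]
  ring

/-- The signed sum over partial permutations inverts the Wick formula. -/
theorem sum_signedWeight_wick [Fintype (I ≃. I)] (d : L → ℂ) (α β : I → L) :
    ∑ π : I ≃. I, signedWeight (fun i j => if β i = α j then 1 else 0) π *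
        wick d α β (domFinset π.symm)ᶜ (domFinset π)ᶜ =
      (∏ j, d (α j)) * ∏ i, starRingEnd ℂ (d (β i)) := by
  rw [sum_signedWeight_mul _ (fun j => d (α j)) _ fun A B b hb => wick_insert d α β A B b hb,
    wick_empty]

variable {Ω : Type*} [MeasurableSpace Ω] {μ : Measure Ω} [IsProbabilityMeasure μ]

theorem integrable_prod_entries (d : L → ℂ) (W : L → Ω → ℂ)
    (hW : ∀ l, HasLaw (W l) stdComplexGaussian μ) (α β : I → L) (A B : Finset I) :
    Integrable (fun ω => (∏ j ∈ A, (d (α j) + W (α j) ω)) *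
      ∏ i ∈ B, starRingEnd ℂ (d (β i) + W (β i) ω)) μ := by
  have h : ∀ l, ∀ r : NNReal, MemLp (fun ω => d l + W l ω) r μ := fun l r => by
    have h1 := memLp_id_stdComplexGaussian r
    rw [← (hW l).map_eq, memLp_map_measure_iff (by fun_prop) (hW l).aemeasurable] at h1
    exact (memLp_const (d l)).add h1
  have := integrable_prod_of_memLp (μ := μ) (A.disjSum B)
    (fun s ω => Sum.elim (fun j => d (α j) + W (α j) ω)
      (fun i => starRingEnd ℂ (d (β i) + W (β i) ω)) s)
    (by rintro (i | i) - r
        · exact h _ r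
        · exact memLp_conj (h _ r))
  refine this.congr (ae_of_all _ fun ω => ?_)
  simp [Finset.prod_disjSum]

theorem integral_prod_entries (d : L → ℂ) (W : L → Ω → ℂ)
    (hW : ∀ l, HasLaw (W l) stdComplexGaussian μ) (hind : iIndepFun W μ)
    (α β : I → L) (A B : Finset I) :
    ∫ ω, (∏ j ∈ A, (d (α j) + W (α j) ω)) *
      ∏ i ∈ B, starRingEnd ℂ (d (β i) + W (β i) ω) ∂μ = wick d α β A B := by
  have hp : ∀ (S : Finset I) (γ : I → L) (f : L → ℂ),
      ∏ j ∈ S, f (γ j) = ∏ l, f l ^ (S.filter fun j => γ j = l).card := by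
    intro S γ f
    rw [← Finset.prod_fiberwise_of_maps_to (s := S) (t := Finset.univ) (g := γ) (by simp)]
    refine Finset.prod_congr rfl fun l _ => ?_
    rw [Finset.prod_congr rfl (g := fun _ => f l), Finset.prod_const]
    intro i hi
    rw [(Finset.mem_filter.1 hi).2]
  -- Grouping repeated entries makes the integrand a product of functions of distinct independent
  -- variables.
  have h1 : ∀ ω, (∏ j ∈ A, (d (α j) + W (α j) ω)) *
      ∏ i ∈ B, starRingEnd ℂ (d (β i) + W (β i) ω) =
      ∏ l, mono (d l) (A.filter fun j => α j = l).card (B.filter fun i => β i = l).card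
        (W l ω) := by
    intro ω
    rw [hp A α fun l => d l + W l ω, hp B β fun l => starRingEnd ℂ (d l + W l ω),
      ← Finset.prod_mul_distrib]
    rfl
  simp_rw [h1]
  rw [hind.integral_fun_prod_comp (fun l => (hW l).aemeasurable)
    (fun l => (continuous_mono _ _ _).aestronglyMeasurable)]
  refine Finset.prod_congr rfl fun l _ => ?_
  rw [← (hW l).map_eq, integral_map (hW l).aemeasurable
    (continuous_mono _ _ _).aestronglyMeasurable]

end Wick

/-! ### Traces of powers as sums over cyclic labelings -/

section TraceCycles

variable {m : Type*} [Fintype m] [DecidableEq m]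

/-- `A` lists the interior points of a path from `x` to `y`; `cons` lists the starting points of its
steps and `snoc` their end points. -/
theorem pow_succ_apply_eq_sum (M : Matrix m m ℂ) (l : ℕ) (x y : m) :
    (M ^ (l + 1)) x y = ∑ A : Fin l → m, ∏ j : Fin (l + 1),
      M ((Fin.cons x A : Fin (l + 1) → m) j) ((Fin.snoc A y : Fin (l + 1) → m) j) := by
  induction l generalizing x with
  | zero => simp [Fin.snoc]
  | succ l ih =>
    rw [pow_succ', Matrix.mul_apply]
    simp_rw [ih, Finset.mul_sum]
    rw [← (Fin.consEquiv fun _ => m).sum_comp, Fintype.sum_prod_type]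
    refine Finset.sum_congr rfl fun z _ => Finset.sum_congr rfl fun A _ => ?_
    rw [Fin.prod_univ_succ (n := l + 1)]
    simp only [Fin.consEquiv_apply, Fin.cons_zero, Fin.cons_succ]
    congr 1
    refine Finset.prod_congr rfl fun j _ => ?_
    have h : (Fin.snoc (Fin.cons z A : Fin (l + 1) → m) y : Fin (l + 2) → m) =
      Fin.cons z (Fin.snoc A y : Fin (l + 1) → m) :=
        (Fin.cons_snoc_eq_snoc_cons (β := m) z A y).symm
    change _ = M _ ((Fin.snoc (Fin.cons z A : Fin (l + 1) → m) y : Fin (l + 2) → m) j.succ)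
    rw [h, Fin.cons_succ]

theorem trace_pow_eq_sum (M : Matrix m m ℂ) {l : ℕ} (hl : 0 < l) :
    (M ^ l).trace = ∑ A : Fin l → m, ∏ j, M (A j) (A (finRotate l j)) := by
  obtain ⟨l, rfl⟩ := Nat.exists_eq_succ_of_ne_zero hl.ne'
  simp only [Nat.succ_eq_add_one, Matrix.trace, Matrix.diag_apply, pow_succ_apply_eq_sum]
  rw [← (Fin.consEquiv fun _ => m).sum_comp, Fintype.sum_prod_type]
  refine Finset.sum_congr rfl fun z _ => Finset.sum_congr rfl fun A _ => ?_
  -- For a closed path the list of end points is the rotated list of starting points.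
  rw [Fin.snoc_eq_cons_rotate]
  rfl

/-- Expansion of a product of traces over the disjoint union of circles. -/
theorem prod_trace_pow_eq_sum {κ : Type*} [Fintype κ] [DecidableEq κ] (M : Matrix m m ℂ)
    (l : κ → ℕ) (hl : ∀ c, 0 < l c) :
    ∏ c, (M ^ l c).trace = ∑ A : (Σ c, Fin (l c)) → m,
      ∏ s : Σ c, Fin (l c), M (A s) (A ⟨s.1, finRotate (l s.1) s.2⟩) := by
  simp_rw [fun c => trace_pow_eq_sum M (hl c)]
  rw [Fintype.prod_sum, ← (Equiv.piCurry fun (c : κ) (_ : Fin (l c)) => m).sum_comp]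
  refine Finset.sum_congr rfl fun A _ => ?_
  rw [Fintype.prod_sigma]
  rfl

variable {O : Type*} [Fintype O] [DecidableEq O]

/-- A cycle of `τ` is a rotation. -/
theorem exists_equiv_fin_of_cycle (τ : Equiv.Perm O)
    (c : Quotient (Equiv.Perm.SameCycle.setoid τ)) :
    ∃ e : Fin (Nat.card {j : O // Quotient.mk (Equiv.Perm.SameCycle.setoid τ) j = c}) ≃
        {j : O // Quotient.mk (Equiv.Perm.SameCycle.setoid τ) j = c},
      ∀ k, (e (finRotate _ k) : O) = τ (e k) := by
  classical
  obtain ⟨x, rfl⟩ := Quotient.exists_rep c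
  set s : Finset O := Finset.univ.filter fun j => τ.SameCycle x j with hs
  have hmem : ∀ j, j ∈ s ↔ τ.SameCycle x j := fun j => by simp [hs]
  have hx : x ∈ s := (hmem x).2 (Equiv.Perm.SameCycle.refl _ _)
  have hcyc : τ.IsCycleOn s := by
    refine ⟨⟨fun j hj => ?_, τ.injective.injOn, fun j hj => ?_⟩, fun i hi j hj => ?_⟩
    · have := (hmem j).1 hj
      exact (hmem _).2 (Equiv.Perm.sameCycle_apply_right.2 this)
    · have := (hmem j).1 hj
      exact ⟨τ⁻¹ j, (hmem _).2 (Equiv.Perm.sameCycle_symm_apply_right.2 this), by simp⟩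
    · exact ((hmem i).1 hi).symm.trans ((hmem j).1 hj)
  have hq : ∀ j, Quotient.mk (Equiv.Perm.SameCycle.setoid τ) j =
      Quotient.mk (Equiv.Perm.SameCycle.setoid τ) x ↔ τ.SameCycle x j := fun j =>
    ⟨fun h => (Quotient.exact h : τ.SameCycle j x).symm, fun h => Quotient.sound h.symm⟩
  have hcard : Nat.card {j : O // Quotient.mk (Equiv.Perm.SameCycle.setoid τ) j =
      Quotient.mk (Equiv.Perm.SameCycle.setoid τ) x} = s.card := by
    rw [Nat.card_eq_fintype_card, Fintype.card_subtype]
    congr 1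
    ext j
    simp [hq, hs]
  rw [show Nat.card {j : O // Quotient.mk (Equiv.Perm.SameCycle.setoid τ) j =
    (Quotient.mk _ x : Quotient (Equiv.Perm.SameCycle.setoid τ))} = s.card from hcard]
  let f : Fin s.card → {j : O // Quotient.mk (Equiv.Perm.SameCycle.setoid τ) j =
      Quotient.mk (Equiv.Perm.SameCycle.setoid τ) x} := fun k =>
    ⟨(τ ^ (k : ℕ)) x, (hq _).2 (Equiv.Perm.sameCycle_pow_right.2 (Equiv.Perm.SameCycle.refl _ _))⟩
  have hsurj : Function.Surjective f := by
    rintro ⟨j, hj⟩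
    obtain ⟨n, hn, h⟩ := hcyc.exists_pow_eq hx ((hmem j).2 ((hq j).1 hj))
    exact ⟨⟨n, hn⟩, Subtype.ext h⟩
  have hbij : Function.Bijective f :=
    (Fintype.bijective_iff_surjective_and_card f).2
      ⟨hsurj, by rw [Fintype.card_fin, ← Nat.card_eq_fintype_card, hcard]⟩
  refine ⟨Equiv.ofBijective f hbij, fun k => ?_⟩
  change (τ ^ ((finRotate _ k : Fin s.card) : ℕ)) x = τ ((τ ^ (k : ℕ)) x)
  rw [← Equiv.Perm.mul_apply, ← pow_succ']
  have hpos : 0 < s.card := Finset.card_pos.2 ⟨x, hx⟩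
  -- The last index wraps around to `0`; a congruence suffices because powers of `τ` at `x` depend
  -- on the exponent only modulo the cycle length.
  have hv : ((finRotate _ k : Fin s.card) : ℕ) ≡ (k : ℕ) + 1 [MOD s.card] := by
    have : NeZero s.card := ⟨hpos.ne'⟩
    rw [finRotate_apply, Fin.val_add, Fin.val_one']
    exact (Nat.mod_modEq _ _).trans ((Nat.ModEq.refl _).add (Nat.mod_modEq _ _))
  exact (hcyc.pow_apply_eq_pow_apply hx).2 hv

/-- The sum over labelings factors over the cycles of `τ` as a product of traces. -/
theorem sum_prod_perm_eq_prod_trace (M : Matrix m m ℂ) (τ : Equiv.Perm O)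
    [Fintype (Quotient (Equiv.Perm.SameCycle.setoid τ))] :
    ∑ A : O → m, ∏ j, M (A j) (A (τ j)) =
      ∏ c : Quotient (Equiv.Perm.SameCycle.setoid τ),
        (M ^ Nat.card {j : O // Quotient.mk (Equiv.Perm.SameCycle.setoid τ) j = c}).trace := by
  classical
  choose e he using exists_equiv_fin_of_cycle τ
  rw [prod_trace_pow_eq_sum M _ (fun c => by
    obtain ⟨x, rfl⟩ := Quotient.exists_rep c
    have : Nonempty {j : O // Quotient.mk (Equiv.Perm.SameCycle.setoid τ) j =
      Quotient.mk (Equiv.Perm.SameCycle.setoid τ) x} := ⟨⟨x, rfl⟩⟩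
    exact Nat.card_pos)]
  -- The cycles, each parametrized as a rotation, make up all of `O`.
  let E : (Σ c : Quotient (Equiv.Perm.SameCycle.setoid τ),
      Fin (Nat.card {j : O // Quotient.mk (Equiv.Perm.SameCycle.setoid τ) j = c})) ≃ O :=
    (Equiv.sigmaCongrRight e).trans (Equiv.sigmaFiberEquiv _)
  have hE : ∀ s, E ⟨s.1, finRotate _ s.2⟩ = τ (E s) := fun s => he s.1 s.2
  rw [← (Equiv.arrowCongr E (Equiv.refl m)).sum_comp]
  refine Finset.sum_congr rfl fun A _ => ?_
  rw [← E.prod_comp]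
  refine Finset.prod_congr rfl fun s _ => ?_
  rw [← hE]
  simp [Equiv.arrowCongr]

end TraceCycles

/-! ### Components of a partial injection: chains and cycles -/

section Chains

open Relation

variable {V : Type*} {r : V → V → Prop}

/-- Unique successors and unique predecessors prevent branching, so connected points lie on one
directed path. -/
theorem reflTransGen_or_of_eqvGen (hl : ∀ a b c, r a c → r b c → a = b)
    (hr : ∀ a b c, r a b → r a c → b = c) {x y : V} (h : EqvGen r x y) :
    ReflTransGen r x y ∨ ReflTransGen r y x := by
  have hl' : Relator.RightUnique (Function.swap r) := fun a b c h1 h2 => hl b c a h1 h2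
  have hr' : Relator.RightUnique r := fun a b c h1 h2 => hr a b c h1 h2
  induction h with
  | rel x y h => exact Or.inl (ReflTransGen.single h)
  | refl x => exact Or.inl ReflTransGen.refl
  | symm x y _ ih => exact ih.symm
  | trans x y z _ _ ih1 ih2 =>
    rcases ih1 with h1 | h1 <;> rcases ih2 with h2 | h2
    · exact Or.inl (h1.trans h2)
    · rw [← reflTransGen_swap] at h1 h2 ⊢
      rcases h1.total_of_right_unique hl' h2 with h | h
      · exact Or.inr (reflTransGen_swap.1 h)
      · exact Or.inl h
    · exact h1.total_of_right_unique hr' h2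
    · exact Or.inr (h2.trans h1)

theorem eq_of_eqvGen_of_source (hl : ∀ a b c, r a c → r b c → a = b)
    (hr : ∀ a b c, r a b → r a c → b = c) {x y : V} (h : EqvGen r x y)
    (hx : ∀ w, ¬ r w x) (hy : ∀ w, ¬ r w y) : x = y := by
  rcases reflTransGen_or_of_eqvGen hl hr h with h | h
  · rcases h.cases_tail with h | ⟨w, -, h⟩
    · exact h.symm
    · exact absurd h (hy w)
  · rcases h.cases_tail with h | ⟨w, -, h⟩
    · exact h
    · exact absurd h (hx w)

/-- Otherwise a choice of successor on the finite set of points reachable from `x` would be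
injective, hence surjective, and `x` would have a predecessor. -/
theorem exists_sink_of_source [Finite V] (hl : ∀ a b c, r a c → r b c → a = b) {x : V}
    (hx : ∀ w, ¬ r w x) : ∃ y, EqvGen r x y ∧ ∀ w, ¬ r y w := by
  by_contra! hcon
  have h1 : ∀ y : {y // ReflTransGen r x y}, ∃ w : {y // ReflTransGen r x y}, r y w := by
    rintro ⟨y, hy⟩
    obtain ⟨w, hw⟩ := hcon y (EqvGen.reflTransGen_le_eqvGen r _ _ hy)
    exact ⟨⟨w, hy.tail hw⟩, hw⟩
  choose g hg using h1
  have hinj : Function.Injective g := fun y z h => by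
    have := hg z
    rw [← h] at this
    exact Subtype.ext (hl _ _ _ (hg y) this)
  obtain ⟨y, hy⟩ := (Finite.injective_iff_surjective.1 hinj) ⟨x, ReflTransGen.refl⟩
  have := hg y
  rw [hy] at this
  exact hx _ this

theorem eqvGen_swap {x y : V} (h : EqvGen (Function.swap r) x y) : EqvGen r x y := by
  induction h with
  | rel x y h => exact EqvGen.symm _ _ (EqvGen.rel _ _ h)
  | refl x => exact EqvGen.refl _
  | symm x y _ ih => exact EqvGen.symm _ _ ih
  | trans x y z _ _ ih1 ih2 => exact EqvGen.trans _ _ _ ih1 ih2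

theorem exists_source_of_sink [Finite V] (hr : ∀ a b c, r a b → r a c → b = c) {x : V}
    (hx : ∀ w, ¬ r x w) : ∃ y, EqvGen r x y ∧ ∀ w, ¬ r w y := by
  obtain ⟨y, h1, h2⟩ := exists_sink_of_source (r := Function.swap r)
    (fun a b c h1 h2 => hr c a b h1 h2) (x := x) hx
  exact ⟨y, eqvGen_swap h1, h2⟩

end Chains

/-! ### Labelings constant on blocks -/

section Labelings

variable {I O Q m : Type*} [Fintype I] [Fintype O] [Fintype m]

/-- The `k` labels outside the range of `g` are free. -/
theorem sum_comp_injective [Fintype Q] [DecidableEq O] [DecidableEq Q] (g : O → Q)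
    (hg : Function.Injective g) (h : (O → m) → ℂ) (k : ℕ)
    (hk : Fintype.card Q = Fintype.card O + k) :
    ∑ B : Q → m, h (B ∘ g) = (Fintype.card m : ℂ) ^ k * ∑ A : O → m, h A := by
  classical
  let E : O ⊕ ((Set.range g)ᶜ : Set Q) ≃ Q :=
    ((Equiv.ofInjective g hg).sumCongr (Equiv.refl _)).trans (Equiv.Set.sumCompl (Set.range g))
  have hE : ∀ o, E (Sum.inl o) = g o := fun o => rfl
  have hR : Fintype.card ((Set.range g)ᶜ : Set Q) = k := by
    have := Fintype.card_congr E
    rw [Fintype.card_sum] at this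
    omega
  let F : (Q → m) ≃ (O → m) × (((Set.range g)ᶜ : Set Q) → m) :=
    (Equiv.arrowCongr E.symm (Equiv.refl m)).trans (Equiv.sumArrowEquivProdArrow _ _ _)
  have hF : ∀ B : Q → m, (F B).1 = B ∘ g := fun B => rfl
  simp_rw [← hF]
  rw [F.sum_comp (fun x => h x.1), Fintype.sum_prod_type]
  simp only [Finset.sum_const, Finset.card_univ, Fintype.card_pi, Finset.prod_const, hR,
    nsmul_eq_mul, Nat.cast_pow, Finset.mul_sum]

/-- The sum over all labelings of `I` that are constant on the fibers of `f`, of a function that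
depends only on the labels of a system `O` of elements in different fibers. -/
theorem sum_compatible_labelings [DecidableEq I] [DecidableEq O] (f : I → Q) (v : O → I)
    (hv : Function.Injective (f ∘ v)) (h : (O → m) → ℂ) (k : ℕ)
    (hk : Nat.card (Set.range f) = Nat.card O + k) (P : (I → m) → Prop) [DecidablePred P]
    (hP : ∀ a, P a ↔ ∀ x y, f x = f y → a x = a y) :
    ∑ a : I → m, (if P a then h (a ∘ v) else 0) =
      (Fintype.card m : ℂ) ^ k * ∑ A : O → m, h A := by
  classical
  have : Fintype (Set.range f) := Fintype.ofFinite _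
  rw [← Finset.sum_filter, ← sum_comp_injective (Q := Set.range f)
    (Set.rangeFactorization f ∘ v) (fun x y hxy => hv (congrArg Subtype.val hxy)) h k
    (by simpa only [Nat.card_eq_fintype_card] using hk)]
  symm
  refine Finset.sum_bij (fun B _ => B ∘ Set.rangeFactorization f) ?_ ?_ ?_ ?_
  · intro B _
    simp only [Finset.mem_filter, Finset.mem_univ, true_and, hP]
    intro x y hxy
    exact congrArg B (Subtype.ext hxy)
  · intro B _ B' _ hB
    exact Set.rangeFactorization_surjective.injective_comp_right hB
  · intro a ha
    simp only [Finset.mem_filter, Finset.mem_univ, true_and, hP] at ha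
    refine ⟨fun q => a (Function.surjInv Set.rangeFactorization_surjective q), Finset.mem_univ _,
      ?_⟩
    funext x
    exact ha _ _ (congrArg Subtype.val
      (Function.surjInv_eq (Set.rangeFactorization_surjective (f := f)) (Set.rangeFactorization f x)))
  · intro B _
    rfl

end Labelings

/-! ### Vertex blocks of the glued circles -/

section Circles

variable {k : ℕ} {p : Fin k → ℕ} (π : SP p)

/-- The cyclic successor as a permutation. -/
def nextEquiv : Equiv.Perm (Idx p) := Equiv.sigmaCongrRight fun i => finRotate (p i)

theorem next_injective : Function.Injective (next : Idx p → Idx p) := nextEquiv.injective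

theorem glue_inr_inr {i j : Idx p} : Glue π (.inr i) (.inr j) ↔ j ∈ π i := by
  constructor
  · intro h
    generalize hv : (Sum.inr i : Vertex p) = v at h
    generalize hw : (Sum.inr j : Vertex p) = w at h
    cases h with
    | start_end i' j' h =>
      cases hv; cases hw; exact h
    | end_start i' j' h => cases hv
  · exact fun h => Glue.start_end i j h

/-- Opposite orientation matches the end of the even edge of `i`, which is the odd vertex of `next
i`, with the start of the odd edge of `j`. -/
theorem glue_inl_inl {x j : Idx p} : Glue π (.inl x) (.inl j) ↔ ∃ i, next i = x ∧ j ∈ π i := by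
  constructor
  · intro h
    generalize hv : (Sum.inl x : Vertex p) = v at h
    generalize hw : (Sum.inl j : Vertex p) = w at h
    cases h with
    | start_end i' j' h => cases hv
    | end_start i' j' h =>
      cases hv; cases hw; exact ⟨i', rfl, h⟩
  · rintro ⟨i, rfl, h⟩
    exact Glue.end_start i j h

theorem not_glue_inl_inr {x y : Idx p} : ¬ Glue π (.inl x) (.inr y) := by
  intro h
  generalize hv : (Sum.inl x : Vertex p) = v at h
  generalize hw : (Sum.inr y : Vertex p) = w at h
  cases h with
  | start_end i' j' h => cases hv
  | end_start i' j' h => cases hw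

theorem not_glue_inr_inl {x y : Idx p} : ¬ Glue π (.inr x) (.inl y) := by
  intro h
  generalize hv : (Sum.inr x : Vertex p) = v at h
  generalize hw : (Sum.inl y : Vertex p) = w at h
  cases h with
  | start_end i' j' h => cases hw
  | end_start i' j' h => cases hv

/-- Together with `glue_right_unique` this makes the gluing a partial injection, so the chain lemmas
apply to the blocks. -/
theorem glue_left_unique (a b c : Vertex p) (h1 : Glue π a c) (h2 : Glue π b c) : a = b := by
  rcases a with a | a <;> rcases b with b | b <;> rcases c with c | c <;>
    simp only [glue_inr_inr, glue_inl_inl, not_glue_inl_inr, not_glue_inr_inl] at h1 h2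
  · obtain ⟨i, rfl, h1⟩ := h1
    obtain ⟨j, rfl, h2⟩ := h2
    rw [π.inj h1 h2]
  · rw [π.inj h1 h2]

theorem glue_right_unique (a b c : Vertex p) (h1 : Glue π a b) (h2 : Glue π a c) : b = c := by
  rcases a with a | a <;> rcases b with b | b <;> rcases c with c | c <;>
    simp only [glue_inr_inr, glue_inl_inl, not_glue_inl_inr, not_glue_inr_inl] at h1 h2
  · obtain ⟨i, rfl, h1⟩ := h1
    obtain ⟨j, hj, h2⟩ := h2
    rw [next_injective hj] at h2
    rw [Option.mem_unique h1 h2]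
  · rw [Option.mem_unique h1 h2]

theorem vertexBlock_eq_iff {v w : Vertex p} :
    vertexBlock π v = vertexBlock π w ↔ Relation.EqvGen (Glue π) v w :=
  ⟨fun h => Quotient.exact h, fun h => Quotient.sound h⟩

/-- A labeling that respects the identifications is constant on the vertex blocks. -/
theorem eq_of_vertexBlock_eq {T : Type*} (F : Vertex p → T) (hF : ∀ v w, Glue π v w → F v = F w)
    {v w : Vertex p} (h : vertexBlock π v = vertexBlock π w) : F v = F w := by
  rw [vertexBlock_eq_iff] at h
  induction h with
  | rel x y h => exact hF _ _ h
  | refl x => rfl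
  | symm x y _ ih => exact ih.symm
  | trans x y z _ _ ih1 ih2 => exact ih1.trans ih2

theorem isLeft_eq_of_vertexBlock_eq {v w : Vertex p}
    (h : vertexBlock π v = vertexBlock π w) : v.isLeft = w.isLeft := by
  refine eq_of_vertexBlock_eq π Sum.isLeft (fun v w h => ?_) h
  cases h <;> rfl

theorem vertexBlock_inl_ne_inr (x y : Idx p) :
    vertexBlock π (.inl x) ≠ vertexBlock π (.inr y) := fun h => by
  simpa using isLeft_eq_of_vertexBlock_eq π h

/-- The indices of the deterministic odd edges. -/
abbrev DetOdd : Type := {s : Idx p // IsDet π (.inl s)}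

/-- The indices of the deterministic even edges. -/
abbrev DetEven : Type := {s : Idx p // IsDet π (.inr s)}

/-- Both ends of a deterministic odd edge are sources of the gluing; dually, both ends of a
deterministic even edge are sinks. -/
theorem not_glue_inl_of_detOdd (j : DetOdd π) (w : Vertex p) : ¬ Glue π w (.inl j.1) := by
  rcases w with w | w
  · rw [glue_inl_inl]
    rintro ⟨i, -, h⟩
    exact j.2 i h
  · exact not_glue_inr_inl π

theorem not_glue_inr_of_detOdd (j : DetOdd π) (w : Vertex p) : ¬ Glue π w (.inr j.1) := by
  rcases w with w | w
  · exact not_glue_inl_inr π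
  · rw [glue_inr_inr]
    exact j.2 w

theorem not_glue_inl_of_detEven (i : DetEven π) (w : Vertex p) : ¬ Glue π (.inl (next i.1)) w := by
  rcases w with w | w
  · rw [glue_inl_inl]
    rintro ⟨i', hi, h⟩
    rw [next_injective hi] at h
    exact i.2 w h
  · exact not_glue_inl_inr π

theorem not_glue_inr_of_detEven (i : DetEven π) (w : Vertex p) : ¬ Glue π (.inr i.1) w := by
  rcases w with w | w
  · exact not_glue_inr_inl π
  · rw [glue_inr_inr]
    exact i.2 w

theorem vertexBlock_inl_injective_detOdd :
    Function.Injective fun j : DetOdd π => vertexBlock π (.inl j.1) := fun j j' h =>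
  Subtype.ext (Sum.inl_injective (eq_of_eqvGen_of_source (glue_left_unique π)
    (glue_right_unique π) ((vertexBlock_eq_iff π).1 h) (not_glue_inl_of_detOdd π j)
    (not_glue_inl_of_detOdd π j')))

theorem vertexBlock_inr_injective_detOdd :
    Function.Injective fun j : DetOdd π => vertexBlock π (.inr j.1) := fun j j' h =>
  Subtype.ext (Sum.inr_injective (eq_of_eqvGen_of_source (glue_left_unique π)
    (glue_right_unique π) ((vertexBlock_eq_iff π).1 h) (not_glue_inr_of_detOdd π j)
    (not_glue_inr_of_detOdd π j')))

theorem eq_of_vertexBlock_eq_of_sink {x y : Vertex p} (h : vertexBlock π x = vertexBlock π y)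
    (hx : ∀ w, ¬ Glue π x w) (hy : ∀ w, ¬ Glue π y w) : x = y := by
  have h' : Relation.EqvGen (Function.swap (Glue π)) x y :=
    eqvGen_swap (r := Function.swap (Glue π)) ((vertexBlock_eq_iff π).1 h)
  exact eq_of_eqvGen_of_source (r := Function.swap (Glue π))
    (fun a b c h1 h2 => glue_right_unique π c a b h1 h2)
    (fun a b c h1 h2 => glue_left_unique π b c a h1 h2) h' hx hy

/-- Each even vertex block with a deterministic edge joins exactly one deterministic odd edge to
one deterministic even edge. -/
theorem exists_equiv_even : ∃ c : DetOdd π ≃ DetEven π,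
    ∀ j, vertexBlock π (.inr j.1) = vertexBlock π (.inr (c j).1) := by
  have h1 : ∀ j : DetOdd π, ∃ i : DetEven π,
      vertexBlock π (.inr j.1) = vertexBlock π (.inr i.1) := by
    intro j
    -- The sink of the chain starting at `j` has no image under `π`, so it is the start of a
    -- deterministic even edge.
    obtain ⟨y, hy, hs⟩ := exists_sink_of_source (glue_left_unique π) (not_glue_inr_of_detOdd π j)
    rw [← vertexBlock_eq_iff] at hy
    rcases y with y | y
    · exact absurd hy.symm (vertexBlock_inl_ne_inr π _ _)
    · exact ⟨⟨y, fun w hw => hs (.inr w) ((glue_inr_inr π).2 hw)⟩, hy⟩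
  choose c hc using h1
  refine ⟨Equiv.ofBijective c ⟨fun j j' h => ?_, fun i => ?_⟩, hc⟩
  · exact vertexBlock_inr_injective_detOdd π ((hc j).trans ((congrArg (fun i : DetEven π =>
      vertexBlock π (.inr i.1)) h).trans (hc j').symm))
  · obtain ⟨y, hy, hs⟩ := exists_source_of_sink (glue_right_unique π)
      (not_glue_inr_of_detEven π i)
    rw [← vertexBlock_eq_iff] at hy
    rcases y with y | y
    · exact absurd hy.symm (vertexBlock_inl_ne_inr π _ _)
    · refine ⟨⟨y, fun w hw => hs (.inr w) ((glue_inr_inr π).2 hw)⟩, ?_⟩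
      exact Subtype.ext (Sum.inr_injective (eq_of_vertexBlock_eq_of_sink π
        ((hc _).symm.trans hy.symm) (not_glue_inr_of_detEven π _) (not_glue_inr_of_detEven π _)))

/-- Each odd vertex block with a deterministic edge joins exactly one deterministic odd edge to
one deterministic even edge. -/
theorem exists_equiv_odd : ∃ c : DetOdd π ≃ DetEven π,
    ∀ j, vertexBlock π (.inl j.1) = vertexBlock π (.inl (next (c j).1)) := by
  have h1 : ∀ j : DetOdd π, ∃ i : DetEven π,
      vertexBlock π (.inl j.1) = vertexBlock π (.inl (next i.1)) := by
    intro j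
    obtain ⟨y, hy, hs⟩ := exists_sink_of_source (glue_left_unique π) (not_glue_inl_of_detOdd π j)
    rw [← vertexBlock_eq_iff] at hy
    rcases y with y | y
    · obtain ⟨i, rfl⟩ := nextEquiv.surjective y
      exact ⟨⟨i, fun w hw => hs (.inl w) ((glue_inl_inl π).2 ⟨i, rfl, hw⟩)⟩, hy⟩
    · exact absurd hy (vertexBlock_inl_ne_inr π _ _)
  choose c hc using h1
  refine ⟨Equiv.ofBijective c ⟨fun j j' h => ?_, fun i => ?_⟩, hc⟩
  · exact vertexBlock_inl_injective_detOdd π ((hc j).trans ((congrArg (fun i : DetEven π =>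
      vertexBlock π (.inl (next i.1))) h).trans (hc j').symm))
  · obtain ⟨y, hy, hs⟩ := exists_source_of_sink (glue_right_unique π)
      (not_glue_inl_of_detEven π i)
    rw [← vertexBlock_eq_iff] at hy
    rcases y with y | y
    · refine ⟨⟨y, fun w hw => hs (.inl (next w)) ((glue_inl_inl π).2 ⟨w, rfl, hw⟩)⟩, ?_⟩
      exact Subtype.ext (next_injective (Sum.inl_injective (eq_of_vertexBlock_eq_of_sink π
        ((hc _).symm.trans hy.symm) (not_glue_inl_of_detEven π _) (not_glue_inl_of_detEven π _))))
    · exact absurd hy (vertexBlock_inl_ne_inr π _ _)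

end Circles

/-! ### Counting blocks and deterministic edges -/

section Counting

variable {k : ℕ} {p : Fin k → ℕ} (π : SP p)

theorem exists_rep_vertexBlock (b : VertexBlock π) : ∃ v, vertexBlock π v = b :=
  Quotient.exists_rep b

theorem isOddBlock_iff (b : VertexBlock π) :
    IsOddBlock π b ↔ b ∈ Set.range fun x : Idx p => vertexBlock π (.inl x) := by
  constructor
  · intro h
    obtain ⟨v, rfl⟩ := exists_rep_vertexBlock π b
    rcases v with v | v
    · exact ⟨v, rfl⟩
    · simpa using h _ rfl
  · rintro ⟨x, rfl⟩ v hv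
    simpa using isLeft_eq_of_vertexBlock_eq π hv

theorem isEvenBlock_iff (b : VertexBlock π) :
    IsEvenBlock π b ↔ b ∈ Set.range fun x : Idx p => vertexBlock π (.inr x) := by
  constructor
  · intro h
    obtain ⟨v, rfl⟩ := exists_rep_vertexBlock π b
    rcases v with v | v
    · simpa using h _ rfl
    · exact ⟨v, rfl⟩
  · rintro ⟨x, rfl⟩ v hv
    have := isLeft_eq_of_vertexBlock_eq π hv
    rcases v with v | v <;> simp_all

theorem lOdd_eq : lOdd π = Nat.card (Set.range fun x : Idx p => vertexBlock π (.inl x)) :=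
  Nat.card_congr (Equiv.subtypeEquivRight fun b => isOddBlock_iff π b)

theorem kEven_eq : kEven π = Nat.card (Set.range fun x : Idx p => vertexBlock π (.inr x)) :=
  Nat.card_congr (Equiv.subtypeEquivRight fun b => isEvenBlock_iff π b)

/-- Every chain has a source as well as a sink, so odd edges alone detect all bordering blocks. -/
theorem exists_detOdd_of_borders {e : Edge p} (he : IsDet π e) {b : VertexBlock π}
    (h : Borders π e b) :
    ∃ j : DetOdd π, b = vertexBlock π (.inl j.1) ∨ b = vertexBlock π (.inr j.1) := by
  obtain ⟨c₁, h₁⟩ := exists_equiv_even π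
  obtain ⟨c₂, h₂⟩ := exists_equiv_odd π
  rcases e with s | s
  · exact ⟨⟨s, he⟩, h.imp Eq.symm Eq.symm⟩
  · rcases h with h | h
    · refine ⟨c₁.symm ⟨s, he⟩, Or.inr ?_⟩
      rw [h₁, Equiv.apply_symm_apply]
      exact h.symm
    · refine ⟨c₂.symm ⟨s, he⟩, Or.inl ?_⟩
      rw [h₂, Equiv.apply_symm_apply]
      exact h.symm

theorem ldOdd_eq : ldOdd π = Nat.card (DetOdd π) := by
  rw [← Nat.card_range_of_injective (vertexBlock_inl_injective_detOdd π)]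
  refine Nat.card_congr (Equiv.subtypeEquivRight fun b => ?_)
  rw [isOddBlock_iff]
  constructor
  · rintro ⟨⟨x, rfl⟩, e, he, hb⟩
    obtain ⟨j, h | h⟩ := exists_detOdd_of_borders π he hb
    · exact ⟨j, h.symm⟩
    · exact absurd h (vertexBlock_inl_ne_inr π _ _)
  · rintro ⟨j, rfl⟩
    exact ⟨⟨j.1, rfl⟩, .inl j.1, j.2, Or.inl rfl⟩

theorem kdEven_eq : kdEven π = Nat.card (DetOdd π) := by
  rw [← Nat.card_range_of_injective (vertexBlock_inr_injective_detOdd π)]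
  refine Nat.card_congr (Equiv.subtypeEquivRight fun b => ?_)
  rw [isEvenBlock_iff]
  constructor
  · rintro ⟨⟨x, rfl⟩, e, he, hb⟩
    obtain ⟨j, h | h⟩ := exists_detOdd_of_borders π he hb
    · exact absurd h.symm (vertexBlock_inl_ne_inr π _ _)
    · exact ⟨j, h.symm⟩
  · rintro ⟨j, rfl⟩
    exact ⟨⟨j.1, rfl⟩, .inl j.1, j.2, Or.inr rfl⟩

/-- Needed to replace the integer exponent `l - ld` by a natural subtraction. -/
theorem detOdd_le_lOdd : Nat.card (DetOdd π) ≤ lOdd π := by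
  rw [← ldOdd_eq]
  exact Nat.card_le_card_of_injective (fun b => ⟨b.1, b.2.1⟩) fun b b' h =>
    Subtype.ext (congrArg (fun x => x.1) h)

theorem detOdd_le_kEven : Nat.card (DetOdd π) ≤ kEven π := by
  rw [← kdEven_eq]
  exact Nat.card_le_card_of_injective (fun b => ⟨b.1, b.2.1⟩) fun b b' h =>
    Subtype.ext (congrArg (fun x => x.1) h)

theorem card_detOdd_add_domCard : Nat.card (DetOdd π) + domCard π = ∑ i, p i := by
  classical
  obtain ⟨c, -⟩ := exists_equiv_even π
  rw [Nat.card_congr c, domCard]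
  have h : Nat.card {i : Idx p // ¬ (π i).isSome} = Nat.card (DetEven π) := by
    refine Nat.card_congr (Equiv.subtypeEquivRight fun i => ?_)
    change _ ↔ ∀ j, j ∉ π i
    simp only [Bool.not_eq_true, Option.isSome_eq_false_iff, Option.isNone_iff_eq_none,
      Option.eq_none_iff_forall_not_mem]
  rw [← h, add_comm, Nat.card_eq_fintype_card, Nat.card_eq_fintype_card,
    ← Fintype.card_sum, Fintype.card_congr (Equiv.sumCompl _)]
  simp

end Counting

/-! ### Components of deterministic edges as cycles of a permutation -/

section DeterministicCircles

variable {k : ℕ} {p : Fin k → ℕ} (π : SP p) (c₁ c₂ : DetOdd π ≃ DetEven π)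

/-- The deterministic odd edge that comes just before a deterministic even edge. -/
def oddEdge : DetEdge π → DetOdd π :=
  Sum.elim id c₁.symm ∘ (Equiv.subtypeSum (p := IsDet π))

/-- The cycle of a deterministic edge. -/
def edgeCycle (e : DetEdge π) : Quotient (Equiv.Perm.SameCycle.setoid (c₁.trans c₂.symm)) :=
  Quotient.mk _ (oddEdge π c₁ e)

theorem edgeCycle_surjective : Function.Surjective (edgeCycle π c₁ c₂) := by
  intro c
  obtain ⟨j, rfl⟩ := Quotient.exists_rep c
  exact ⟨⟨.inl j.1, j.2⟩, rfl⟩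

/-- Each odd edge brings along the even edge paired with it by `c₁`, so the halving in `blockLen` is
exact. -/
theorem card_edgeCycle_fiber
    (c : Quotient (Equiv.Perm.SameCycle.setoid (c₁.trans c₂.symm))) :
    Nat.card {e : DetEdge π // edgeCycle π c₁ c₂ e = c} =
      2 * Nat.card {j : DetOdd π // Quotient.mk
        (Equiv.Perm.SameCycle.setoid (c₁.trans c₂.symm)) j = c} := by
  let E : DetEdge π ≃ DetOdd π ⊕ DetOdd π :=
    (Equiv.subtypeSum (p := IsDet π)).trans ((Equiv.refl _).sumCongr c₁.symm)
  let F : {e : DetEdge π // edgeCycle π c₁ c₂ e = c} ≃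
      {j : DetOdd π // Quotient.mk (Equiv.Perm.SameCycle.setoid (c₁.trans c₂.symm)) j = c} ⊕
      {j : DetOdd π // Quotient.mk (Equiv.Perm.SameCycle.setoid (c₁.trans c₂.symm)) j = c} :=
    (E.subtypeEquiv (q := fun x => Quotient.mk (Equiv.Perm.SameCycle.setoid (c₁.trans c₂.symm))
      (Sum.elim id id x) = c) (by
        rintro ⟨e | e, he⟩ <;> rfl)).trans Equiv.subtypeSum
  rw [Nat.card_congr F, Nat.card_sum, two_mul]

variable (h₁ : ∀ j, vertexBlock π (.inr j.1) = vertexBlock π (.inr (c₁ j).1))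
  (h₂ : ∀ j, vertexBlock π (.inl j.1) = vertexBlock π (.inl (next (c₂ j).1)))

include h₁ h₂ in
-- An even edge meets one odd edge at its start, through `c₁`, and one at its end, through `c₂`;
-- these differ by one step of the permutation, hence share a cycle.
theorem exists_edgeCycle_of_borders (e : DetEdge π) {b : VertexBlock π} (h : Borders π e.1 b) :
    ∃ j : DetOdd π, Quotient.mk (Equiv.Perm.SameCycle.setoid (c₁.trans c₂.symm)) j =
      edgeCycle π c₁ c₂ e ∧ (b = vertexBlock π (.inl j.1) ∨ b = vertexBlock π (.inr j.1)) := by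
  rcases e with ⟨s | s, he⟩
  · exact ⟨⟨s, he⟩, rfl, h.imp Eq.symm Eq.symm⟩
  · rcases h with h | h
    · refine ⟨c₁.symm ⟨s, he⟩, rfl, Or.inr ?_⟩
      rw [h₁, Equiv.apply_symm_apply]
      exact h.symm
    · refine ⟨c₂.symm ⟨s, he⟩, ?_, Or.inl ?_⟩
      · refine Quotient.sound ?_
        change Equiv.Perm.SameCycle (c₁.trans c₂.symm) (c₂.symm ⟨s, he⟩) (c₁.symm ⟨s, he⟩)
        have h : (c₁.trans c₂.symm) (c₁.symm ⟨s, he⟩) = c₂.symm ⟨s, he⟩ := by simp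
        rw [← h, Equiv.Perm.sameCycle_apply_left]
      · rw [h₂, Equiv.apply_symm_apply]
        exact h.symm

include h₁ h₂ in
theorem edgeCycle_eq_of_detSetoid {e f : DetEdge π} (h : detSetoid π e f) :
    edgeCycle π c₁ c₂ e = edgeCycle π c₁ c₂ f := by
  induction (h : Relation.EqvGen _ e f) with
  | rel e f h =>
    obtain ⟨b, he, hf⟩ := h
    obtain ⟨j, hj, hb⟩ := exists_edgeCycle_of_borders π c₁ c₂ h₁ h₂ e he
    obtain ⟨j', hj', hb'⟩ := exists_edgeCycle_of_borders π c₁ c₂ h₁ h₂ f hf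
    have : j = j' := by
      rcases hb with rfl | rfl <;> rcases hb' with hb' | hb'
      · exact vertexBlock_inl_injective_detOdd π hb'
      · exact absurd hb' (vertexBlock_inl_ne_inr π _ _)
      · exact absurd hb'.symm (vertexBlock_inl_ne_inr π _ _)
      · exact vertexBlock_inr_injective_detOdd π hb'
    rw [← hj, ← hj', this]
  | refl e => rfl
  | symm e f _ ih => exact ih.symm
  | trans e f g _ _ ih1 ih2 => exact ih1.trans ih2

theorem detSetoid_of_borders {e f : DetEdge π} (b : VertexBlock π) (he : Borders π e.1 b)
    (hf : Borders π f.1 b) : detSetoid π e f :=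
  Relation.EqvGen.rel _ _ ⟨b, he, hf⟩

include h₁ in
theorem detSetoid_oddEdge (e : DetEdge π) :
    detSetoid π e ⟨.inl (oddEdge π c₁ e).1, (oddEdge π c₁ e).2⟩ := by
  rcases e with ⟨s | s, he⟩
  · exact Setoid.refl' _ _
  · refine detSetoid_of_borders π (vertexBlock π (.inr s)) (Or.inl rfl) (Or.inr ?_)
    have := h₁ (c₁.symm ⟨s, he⟩)
    rwa [Equiv.apply_symm_apply] at this

include h₁ h₂ in
-- One step crosses an even block to the even edge `c₁ j`, then an odd block to the next odd edge.
theorem detSetoid_perm (j : DetOdd π) :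
    detSetoid π ⟨.inl j.1, j.2⟩
      ⟨.inl ((c₁.trans c₂.symm) j).1, ((c₁.trans c₂.symm) j).2⟩ := by
  refine Setoid.trans' _ (y := ⟨.inr (c₁ j).1, (c₁ j).2⟩) ?_ ?_
  · exact detSetoid_of_borders π (vertexBlock π (.inr j.1)) (Or.inr rfl) (Or.inl (h₁ j).symm)
  · refine detSetoid_of_borders π (vertexBlock π (.inl ((c₁.trans c₂.symm) j).1)) (Or.inr ?_)
      (Or.inl rfl)
    have := h₂ ((c₁.trans c₂.symm) j)
    rw [this]
    simp [edgeEnd]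

include h₁ h₂ in
theorem detSetoid_iff_edgeCycle_eq {e f : DetEdge π} :
    detSetoid π e f ↔ edgeCycle π c₁ c₂ e = edgeCycle π c₁ c₂ f := by
  refine ⟨edgeCycle_eq_of_detSetoid π c₁ c₂ h₁ h₂, fun h => ?_⟩
  have h' : Equiv.Perm.SameCycle (c₁.trans c₂.symm) (oddEdge π c₁ e) (oddEdge π c₁ f) := Quotient.exact h
  have key : ∀ (n : ℕ) (j : DetOdd π), detSetoid π ⟨.inl j.1, j.2⟩
      ⟨.inl (((c₁.trans c₂.symm) ^ n : Equiv.Perm (DetOdd π)) j).1,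
        (((c₁.trans c₂.symm) ^ n : Equiv.Perm (DetOdd π)) j).2⟩ := by
    intro n
    induction n with
    | zero => exact fun j => Setoid.refl' _ _
    | succ n ih =>
      intro j
      refine Setoid.trans' _ (ih j) ?_
      simp_rw [pow_succ']
      exact detSetoid_perm π c₁ c₂ h₁ h₂ _
  obtain ⟨n, hn⟩ := h'.exists_nat_pow_eq
  have h2 := key n (oddEdge π c₁ e)
  simp_rw [hn] at h2
  exact Setoid.trans' _ (detSetoid_oddEdge π c₁ h₁ e)
    (Setoid.trans' _ h2 (Setoid.symm' _ (detSetoid_oddEdge π c₁ h₁ f)))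

include h₁ h₂ in
/-- The blocks of `σ(π)` are the cycles of the permutation that moves along the deterministic
edges. -/
theorem exists_equiv_detBlock : ∃ ψ : DetBlock π ≃
    Quotient (Equiv.Perm.SameCycle.setoid (c₁.trans c₂.symm)),
    ∀ b, blockLen π b = Nat.card {j : DetOdd π // Quotient.mk
      (Equiv.Perm.SameCycle.setoid (c₁.trans c₂.symm)) j = ψ b} := by
  let ψ : DetBlock π ≃ Quotient (Equiv.Perm.SameCycle.setoid (c₁.trans c₂.symm)) :=
    (Quotient.congr (Equiv.refl _) fun e f => (detSetoid_iff_edgeCycle_eq π c₁ c₂ h₁ h₂ :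
      _ ↔ Setoid.ker (edgeCycle π c₁ c₂) e f)).trans
      (Setoid.quotientKerEquivOfSurjective _ (edgeCycle_surjective π c₁ c₂))
  have hψ : ∀ e, ψ (Quotient.mk _ e) = edgeCycle π c₁ c₂ e := fun e => rfl
  refine ⟨ψ, fun b => ?_⟩
  have h := card_edgeCycle_fiber π c₁ c₂ (ψ b)
  have h' : Nat.card {e : DetEdge π // Quotient.mk (detSetoid π) e = b} =
      Nat.card {e : DetEdge π // edgeCycle π c₁ c₂ e = ψ b} := by
    refine Nat.card_congr (Equiv.subtypeEquivRight fun e => ?_)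
    rw [← hψ, ψ.apply_eq_iff_eq]
  rw [blockLen, h', h, Nat.mul_div_cancel_left _ two_pos]

end DeterministicCircles

/-! ### Summation over labels and the powers of `n` and `N` -/

section LabelSums

variable {k : ℕ} {p : Fin k → ℕ} {m m' : Type*} [Fintype m] [DecidableEq m] [Fintype m']
  [DecidableEq m']

/-- The product of the entries of `Y` along the unidentified edges. -/
noncomputable def entryProd (Y : Matrix m m' ℂ) (a : Idx p → m) (b : Idx p → m')
    (A B : Finset (Idx p)) : ℂ :=
  (∏ j ∈ A, Y (a j) (b j)) * ∏ i ∈ B, starRingEnd ℂ (Y (a (next i)) (b i))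

/-- The indicators of the identifications of a pair. -/
def pairDelta (a : Idx p → m) (b : Idx p → m') (i j : Idx p) : ℂ :=
  if (a (next i), b i) = (a j, b j) then 1 else 0

/-- The row labels come from the traces, the column labels from the inner sums of `Y * Yᴴ`. -/
theorem prod_trace_eq_sum_entryProd (Y : Matrix m m' ℂ) (hp : ∀ i, 0 < p i) :
    ∏ i, ((Y * Yᴴ) ^ p i).trace =
      ∑ a : Idx p → m, ∑ b : Idx p → m', entryProd Y a b Finset.univ Finset.univ := by
  rw [prod_trace_pow_eq_sum _ _ hp]
  refine Finset.sum_congr rfl fun a _ => ?_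
  simp only [entryProd, ← Finset.prod_mul_distrib]
  simp_rw [Matrix.mul_apply]
  rw [Fintype.prod_sum]
  rfl

variable (π : SP p)

theorem compatible_iff (a : Idx p → m) (b : Idx p → m') :
    (∀ i, ∀ j ∈ π i, (a (next i), b i) = (a j, b j)) ↔
      (∀ x y, vertexBlock π (.inl x) = vertexBlock π (.inl y) → a x = a y) ∧
      (∀ x y, vertexBlock π (.inr x) = vertexBlock π (.inr y) → b x = b y) := by
  constructor
  · intro h
    have hF : ∀ v w, Glue π v w → (Sum.map a b v) = Sum.map a b w := by
      intro v w hvw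
      cases hvw with
      | start_end i j hij => exact congrArg Sum.inr (Prod.ext_iff.1 (h i j hij)).2
      | end_start i j hij => exact congrArg Sum.inl (Prod.ext_iff.1 (h i j hij)).1
    exact ⟨fun x y hxy => Sum.inl_injective (eq_of_vertexBlock_eq π _ hF hxy),
      fun x y hxy => Sum.inr_injective (eq_of_vertexBlock_eq π _ hF hxy)⟩
  · rintro ⟨ha, hb⟩ i j hij
    refine Prod.ext (ha _ _ ?_) (hb _ _ ?_)
    · exact (vertexBlock_eq_iff π).2 (.rel _ _ (Glue.end_start i j hij))
    · exact (vertexBlock_eq_iff π).2 (.rel _ _ (Glue.start_end i j hij))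

open Classical in
theorem prod_pairDelta (a : Idx p → m) (b : Idx p → m') :
    ∏ i, (π i).elim 1 (pairDelta a b i) =
      if (∀ x y, vertexBlock π (.inl x) = vertexBlock π (.inl y) → a x = a y) then
        if (∀ x y, vertexBlock π (.inr x) = vertexBlock π (.inr y) → b x = b y) then 1 else 0
      else 0 := by
  have h : ∀ i, (π i).elim 1 (pairDelta a b i) =
      if ∀ j ∈ π i, (a (next i), b i) = (a j, b j) then 1 else 0 := by
    intro i
    cases π i with
    | none => simp
    | some j => simp [pairDelta]
  rw [Finset.prod_congr rfl fun i _ => h i, Finset.prod_boole]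
  simp only [Finset.mem_univ, true_implies, compatible_iff, ite_and]

/-- The sum over all labelings of the vertices in which identified vertices have equal labels. -/
theorem sum_labelings (Y : Matrix m m' ℂ) :
    ∑ a : Idx p → m, ∑ b : Idx p → m', (∏ i, (π i).elim 1 (pairDelta a b i)) *
        entryProd Y a b (domFinset π.symm)ᶜ (domFinset π)ᶜ =
      (Fintype.card m : ℂ) ^ (lOdd π - Nat.card (DetOdd π)) *
        (Fintype.card m' : ℂ) ^ (kEven π - Nat.card (DetOdd π)) *
        ∏ᶠ c : DetBlock π, ((Y * Yᴴ) ^ blockLen π c).trace := by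
  classical
  obtain ⟨c₁, h₁⟩ := exists_equiv_even π
  obtain ⟨c₂, h₂⟩ := exists_equiv_odd π
  set τ : Equiv.Perm (DetOdd π) := c₁.trans c₂.symm with hτ
  obtain ⟨ψ, hψ⟩ : ∃ ψ : DetBlock π ≃ Quotient (Equiv.Perm.SameCycle.setoid τ),
      ∀ b, blockLen π b = Nat.card {j : DetOdd π // Quotient.mk
        (Equiv.Perm.SameCycle.setoid τ) j = ψ b} := exists_equiv_detBlock π c₁ c₂ h₁ h₂
  have hO : ∀ x, x ∈ (domFinset π.symm)ᶜ ↔ IsDet π (.inl x) := by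
    intro x
    rw [Finset.mem_compl, mem_domFinset_symm, not_exists]
    rfl
  have hE : ∀ x, x ∈ (domFinset π)ᶜ ↔ IsDet π (.inr x) := by
    intro x
    rw [Finset.mem_compl, mem_domFinset, not_exists]
    rfl
  let H : (DetOdd π → m) → (DetOdd π → m') → ℂ := fun A B =>
    ∏ j, Y (A j) (B j) * starRingEnd ℂ (Y (A (τ j)) (B j))
  let PA : (Idx p → m) → Prop := fun a =>
    ∀ x y, vertexBlock π (.inl x) = vertexBlock π (.inl y) → a x = a y
  let PB : (Idx p → m') → Prop := fun b =>
    ∀ x y, vertexBlock π (.inr x) = vertexBlock π (.inr y) → b x = b y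
  -- Even edges are reindexed by `c₁`; along `c₁ j` the column label is that of `j` and the row
  -- label is that of `τ j`.
  have hentry : ∀ a b, PA a → PB b → entryProd Y a b (domFinset π.symm)ᶜ (domFinset π)ᶜ =
      H (a ∘ Subtype.val) (b ∘ Subtype.val) := by
    intro a b ha hb
    rw [entryProd, Finset.prod_subtype _ hO, Finset.prod_subtype _ hE, ← c₁.prod_comp,
      ← Finset.prod_mul_distrib]
    refine Finset.prod_congr rfl fun j _ => ?_
    have e1 : b (c₁ j).1 = b j.1 := (hb _ _ (h₁ j)).symm
    have e2 : a (next (c₁ j).1) = a (τ j).1 := by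
      have := ha _ _ (h₂ (τ j))
      rw [this, hτ]
      simp
    rw [e1, e2]
    rfl
  have hterm : ∀ a b, (∏ i, (π i).elim 1 (pairDelta a b i)) *
        entryProd Y a b (domFinset π.symm)ᶜ (domFinset π)ᶜ =
      if PB b then if PA a then H (a ∘ Subtype.val) (b ∘ Subtype.val) else 0 else 0 := by
    intro a b
    rw [prod_pairDelta]
    by_cases ha : PA a
    · by_cases hb : PB b
      · rw [if_pos ha, if_pos hb, if_pos hb, if_pos ha, one_mul, hentry a b ha hb]
      · rw [if_pos ha, if_neg hb, if_neg hb, zero_mul]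
    · by_cases hb : PB b
      · rw [if_neg ha, if_pos hb, if_neg ha, zero_mul]
      · rw [if_neg ha, if_neg hb, zero_mul]
  simp_rw [hterm]
  -- The even blocks without a deterministic edge carry free column labels.
  have hB : ∀ a : Idx p → m, ∑ b : Idx p → m',
      (if PB b then if PA a then H (a ∘ Subtype.val) (b ∘ Subtype.val) else 0 else 0) =
      (Fintype.card m' : ℂ) ^ (kEven π - Nat.card (DetOdd π)) *
        (if PA a then ∑ B, H (a ∘ Subtype.val) B else 0) := by
    intro a
    rw [sum_compatible_labelings (fun x : Idx p => vertexBlock π (.inr x))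
      (Subtype.val : DetOdd π → Idx p) (vertexBlock_inr_injective_detOdd π)
      (fun B => if PA a then H (a ∘ Subtype.val) B else 0) (kEven π - Nat.card (DetOdd π))
      (by rw [← kEven_eq, Nat.add_sub_cancel' (detOdd_le_kEven π)]) PB (fun b => Iff.rfl)]
    congr 1
    split_ifs <;> simp
  simp_rw [hB]
  rw [← Finset.mul_sum, sum_compatible_labelings (fun x : Idx p => vertexBlock π (.inl x))
      (Subtype.val : DetOdd π → Idx p) (vertexBlock_inl_injective_detOdd π)
      (fun A => ∑ B, H A B) (lOdd π - Nat.card (DetOdd π))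
      (by rw [← lOdd_eq, Nat.add_sub_cancel' (detOdd_le_lOdd π)]) PA (fun b => Iff.rfl)]
  -- Summing the remaining columns restores entries of `Y * Yᴴ` along the cycles of `τ`.
  have hA : ∀ A : DetOdd π → m, ∑ B, H A B = ∏ j, (Y * Yᴴ) (A j) (A (τ j)) := by
    intro A
    simp_rw [Matrix.mul_apply]
    rw [Fintype.prod_sum]
    rfl
  simp_rw [hA]
  have : Fintype (DetBlock π) := Fintype.ofFinite _
  have : Fintype (Quotient (Equiv.Perm.SameCycle.setoid τ)) := Fintype.ofFinite _
  rw [sum_prod_perm_eq_prod_trace, finprod_eq_prod_of_fintype, ← ψ.prod_comp]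
  simp_rw [hψ]
  ring

theorem sum_blockLen [Fintype (DetBlock π)] :
    ∑ c : DetBlock π, blockLen π c = Nat.card (DetOdd π) := by
  classical
  obtain ⟨c₁, h₁⟩ := exists_equiv_even π
  obtain ⟨c₂, h₂⟩ := exists_equiv_odd π
  obtain ⟨ψ, hψ⟩ := exists_equiv_detBlock π c₁ c₂ h₁ h₂
  have : Fintype (Quotient (Equiv.Perm.SameCycle.setoid (c₁.trans c₂.symm))) := Fintype.ofFinite _
  simp_rw [hψ]
  rw [ψ.sum_comp (fun c => Nat.card {j : DetOdd π // Quotient.mk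
      (Equiv.Perm.SameCycle.setoid (c₁.trans c₂.symm)) j = c}), ← Nat.card_sigma,
      Nat.card_congr (Equiv.sigmaFiberEquiv _)]

theorem covMoment_eq (Y : Matrix m m' ℂ) (r : ℕ) :
    covMoment Y r = ((Fintype.card m' : ℂ) ^ r)⁻¹ * (Fintype.card m : ℂ)⁻¹ *
      ((Y * Yᴴ) ^ r).trace := by
  rw [covMoment, ntr, smul_pow, Matrix.trace_smul, smul_eq_mul, inv_pow]
  ring

theorem domCard_eq : domCard π = (domFinset π).card := by
  rw [domCard, Nat.card_eq_fintype_card, Fintype.card_subtype, domFinset]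

/-- The estimator as a signed sum over labelings of the vertices. -/
theorem signedSum_eq [Nonempty m] [Nonempty m'] (Y : Matrix m m' ℂ) :
    signedSum (Fintype.card m) (Fintype.card m') p (covMoment Y) =
      ((Fintype.card m : ℂ) ^ k)⁻¹ * ((Fintype.card m' : ℂ) ^ ∑ i, p i)⁻¹ *
        ∑ a : Idx p → m, ∑ b : Idx p → m', ∑ π : SP p, signedWeight (pairDelta a b) π *
          entryProd Y a b (domFinset π.symm)ᶜ (domFinset π)ᶜ := by
  classical
  have hm : (Fintype.card m : ℂ) ≠ 0 := by simp
  have hm' : (Fintype.card m' : ℂ) ≠ 0 := by simp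
  have hswap : ∑ a : Idx p → m, ∑ b : Idx p → m', ∑ π : SP p, signedWeight (pairDelta a b) π *
          entryProd Y a b (domFinset π.symm)ᶜ (domFinset π)ᶜ =
      ∑ π : SP p, ∑ a : Idx p → m, ∑ b : Idx p → m', signedWeight (pairDelta a b) π *
          entryProd Y a b (domFinset π.symm)ᶜ (domFinset π)ᶜ := by
    rw [Finset.sum_congr rfl fun a _ => Finset.sum_comm, Finset.sum_comm]
  rw [hswap, signedSum, Finset.mul_sum]
  refine Finset.sum_congr rfl fun π _ => ?_
  have : Fintype (DetBlock π) := Fintype.ofFinite _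
  have hsum : ∑ a : Idx p → m, ∑ b : Idx p → m', signedWeight (pairDelta a b) π *
          entryProd Y a b (domFinset π.symm)ᶜ (domFinset π)ᶜ =
      (-1) ^ (domFinset π).card * ∑ a : Idx p → m, ∑ b : Idx p → m',
        (∏ i, (π i).elim 1 (pairDelta a b i)) *
          entryProd Y a b (domFinset π.symm)ᶜ (domFinset π)ᶜ := by
    simp only [signedWeight, mul_assoc, Finset.mul_sum]
  rw [hsum, sum_labelings, finprod_eq_prod_of_fintype, finprod_eq_prod_of_fintype, ← domCard_eq]
  simp_rw [covMoment_eq]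
  -- The moments contribute `|σ(π)|` inverse factors `n`, and one inverse `N` per deterministic odd
  -- edge. With the explicit weights this leaves `n ^ (-k)` and `N ^ (-p)`, independent of `π`.
  rw [Finset.prod_mul_distrib, Finset.prod_mul_distrib, Finset.prod_inv_distrib,
    Finset.prod_pow_eq_pow_sum, sum_blockLen, Finset.prod_const, inv_pow, Finset.card_univ,
    show Fintype.card (DetBlock π) = sigmaCard π from Nat.card_eq_fintype_card.symm,
    ← card_detOdd_add_domCard π, ldOdd_eq, kdEven_eq,
    ← Nat.cast_sub (detOdd_le_kEven π), ← Nat.cast_sub (detOdd_le_lOdd π), zpow_natCast,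
    zpow_natCast, zpow_sub₀ hm, zpow_natCast, zpow_natCast, pow_add]
  field_simp

end LabelSums

/-! ### Unbiasedness for one Gaussian matrix -/

section Unbiased

variable {k : ℕ} {p : Fin k → ℕ} {m m' : Type*} [Fintype m] [DecidableEq m] [Fintype m']
  [DecidableEq m'] [Nonempty m] [Nonempty m']
  {Ω : Type*} [MeasurableSpace Ω] {μ : Measure Ω} [IsProbabilityMeasure μ]

/-- Arbitrary finite index types allow the same statement to serve the compound matrix. -/
theorem isUnbiased_signedSum (D : Matrix m m' ℂ) {X : Ω → Matrix m m' ℂ}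
    (hX : IsStdComplexGaussian X μ) (hp : ∀ i, 0 < p i) :
    IsUnbiased μ (fun ω => signedSum (Fintype.card m) (Fintype.card m') p (covMoment (D + X ω)))
      (∏ i, covMoment D (p i)) := by
  classical
  have hlaw : ∀ l : m × m', HasLaw (fun ω => X ω l.1 l.2) stdComplexGaussian μ :=
    fun l => hX.hasLaw _ _
  have hint : ∀ a b (A B : Finset (Idx p)),
      Integrable (fun ω => entryProd (D + X ω) a b A B) μ := fun a b A B =>
    integrable_prod_entries (fun l : m × m' => D l.1 l.2) (fun l ω => X ω l.1 l.2) hlaw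
      (fun j => (a j, b j)) (fun i => (a (next i), b i)) A B
  have hexp : ∀ a b (A B : Finset (Idx p)), ∫ ω, entryProd (D + X ω) a b A B ∂μ =
      wick (fun l : m × m' => D l.1 l.2) (fun j => (a j, b j)) (fun i => (a (next i), b i)) A B :=
    fun a b A B =>
      integral_prod_entries (fun l : m × m' => D l.1 l.2) (fun l ω => X ω l.1 l.2) hlaw hX.indep
        (fun j => (a j, b j)) (fun i => (a (next i), b i)) A B
  have hi1 : ∀ (a : Idx p → m) (b : Idx p → m') (π : SP p), Integrable (fun ω =>
      signedWeight (pairDelta a b) π *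
        entryProd (D + X ω) a b (domFinset π.symm)ᶜ (domFinset π)ᶜ) μ :=
    fun a b π => (hint a b _ _).const_mul _
  have hi2 : ∀ (a : Idx p → m) (b : Idx p → m'), Integrable (fun ω => ∑ π : SP p,
      signedWeight (pairDelta a b) π *
        entryProd (D + X ω) a b (domFinset π.symm)ᶜ (domFinset π)ᶜ) μ :=
    fun a b => integrable_finsetSum _ fun π _ => hi1 a b π
  have hi3 : ∀ a : Idx p → m, Integrable (fun ω => ∑ b : Idx p → m', ∑ π : SP p,
      signedWeight (pairDelta a b) π *
        entryProd (D + X ω) a b (domFinset π.symm)ᶜ (domFinset π)ᶜ) μ :=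
    fun a => integrable_finsetSum _ fun b _ => hi2 a b
  simp_rw [IsUnbiased, signedSum_eq]
  refine ⟨(integrable_finsetSum _ fun a _ => hi3 a).const_mul _, ?_⟩
  rw [integral_const_mul, integral_finsetSum _ fun a _ => hi3 a]
  simp_rw [integral_finsetSum _ fun b _ => hi2 _ b, integral_finsetSum _ fun π _ => hi1 _ _ π,
    integral_const_mul, hexp]
  -- The Wick formula is inverted separately for each labeling.
  have hw : ∀ (a : Idx p → m) (b : Idx p → m'), ∑ π : SP p, signedWeight (pairDelta a b) π *
      wick (fun l : m × m' => D l.1 l.2) (fun j => (a j, b j)) (fun i => (a (next i), b i))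
        (domFinset π.symm)ᶜ (domFinset π)ᶜ = entryProd D a b Finset.univ Finset.univ :=
    fun a b => sum_signedWeight_wick (fun l : m × m' => D l.1 l.2) (fun j => (a j, b j))
      (fun i => (a (next i), b i))
  simp_rw [hw, covMoment_eq]
  rw [← prod_trace_eq_sum_entryProd D hp, Finset.prod_mul_distrib, Finset.prod_mul_distrib,
    Finset.prod_inv_distrib, Finset.prod_pow_eq_pow_sum, Finset.prod_const, Finset.card_univ,
    Fintype.card_fin, inv_pow]
  ring

end Unbiased

/-! ### Compound observation matrices -/

section Compound

variable {n N L₁ L₂ : ℕ} {Ω : Type*} [MeasurableSpace Ω] {μ : Measure Ω} [IsProbabilityMeasure μ]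

/-- Independence between and within families combines for measurable maps, so measurable
modifications are used. -/
theorem iIndepFun_entries {ι κ : Type*} [Countable ι] [Countable κ] {X : ι → κ → Ω → ℂ}
    (mX : ∀ i j, AEMeasurable (X i j) μ) (h1 : iIndepFun (fun i ω j => X i j ω) μ)
    (h2 : ∀ i, iIndepFun (X i) μ) : iIndepFun (fun (s : ι × κ) ω => X s.1 s.2 ω) μ := by
  have h := iIndepFun_uncurry' (P := μ) (X := fun i j => (mX i j).mk (X i j))
    (fun i j => (mX i j).measurable_mk)
    (h1.congr fun i => by
      filter_upwards [ae_all_iff.2 fun j => (mX i j).ae_eq_mk] with ω hω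
      funext j
      exact hω j)
    (fun i => (h2 i).congr fun j => (mX i j).ae_eq_mk)
  exact h.congr fun s => (mX s.1 s.2).ae_eq_mk.symm

theorem isStdComplexGaussian_compound (e : Fin L₁ × Fin L₂ ≃ Fin (L₁ * L₂))
    {X : Fin (L₁ * L₂) → Ω → Matrix (Fin n) (Fin N) ℂ}
    (hX : ∀ l, IsStdComplexGaussian (X l) μ)
    (hind : iIndepFun (fun (l : Fin (L₁ * L₂)) (ω : Ω) (s : Fin n × Fin N) => X l ω s.1 s.2) μ) :
    IsStdComplexGaussian (fun ω => compound e fun l => X l ω) μ where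
  hasLaw a b := (hX (e (a.1, b.1))).hasLaw a.2 b.2
  indep := by
    have h := iIndepFun_entries (X := fun l (s : Fin n × Fin N) ω => X l ω s.1 s.2)
      (fun l s => ((hX l).hasLaw s.1 s.2).aemeasurable) hind (fun l => (hX l).indep)
    exact h.precomp (g := fun s : (Fin L₁ × Fin n) × (Fin L₂ × Fin N) =>
      (e (s.1.1, s.2.1), (s.1.2, s.2.2))) (fun s t hst => by
        simp only [Prod.mk.injEq, EmbeddingLike.apply_eq_iff_eq] at hst
        ext <;> simp [hst])

/-- The compound is an all-ones matrix tensored with `D`; each product over columns gives `L₂`, and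
each further product of all-ones `L₁ × L₁` matrices gives `L₁`. The zeroth power does not have this
shape. -/
theorem compound_const_mul_conjTranspose_pow (e : Fin L₁ × Fin L₂ ≃ Fin (L₁ * L₂))
    (D : Matrix (Fin n) (Fin N) ℂ) (r : ℕ) :
    ((compound e fun _ => D) * (compound e fun _ => D)ᴴ) ^ (r + 1) =
      Matrix.of fun a b => (L₂ : ℂ) ^ (r + 1) * (L₁ : ℂ) ^ r * ((D * Dᴴ) ^ (r + 1)) a.2 b.2 := by
  induction r with
  | zero =>
    ext a b
    simp [Matrix.mul_apply, compound, Fintype.sum_prod_type]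
  | succ r ih =>
    rw [pow_succ, ih]
    ext a b
    have hpow : ((D * Dᴴ) ^ (r + 1 + 1)) a.2 b.2 =
        ∑ x, ((D * Dᴴ) ^ (r + 1)) a.2 x * (D * Dᴴ) x b.2 := by
      rw [pow_succ _ (r + 1), Matrix.mul_apply]
    have h : ∀ x y, ((compound e fun _ => D) * (compound e fun _ => D)ᴴ) x y =
        (L₂ : ℂ) * (D * Dᴴ) x.2 y.2 := by
      intro x y
      simp [Matrix.mul_apply, compound, Fintype.sum_prod_type]
    rw [Matrix.mul_apply]
    simp only [h, Matrix.of_apply, hpow, Fintype.sum_prod_type,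
      Finset.sum_const, Finset.card_univ, Fintype.card_fin, nsmul_eq_mul, Finset.mul_sum]
    refine Finset.sum_congr rfl fun x _ => ?_
    ring

/-- The normalization by the number of columns removes all `L₂`. The block trace adds one `L₁`,
which the normalized trace divides out again. -/
theorem covMoment_compound_const (hL₁ : 0 < L₁) (hL₂ : 0 < L₂)
    (e : Fin L₁ × Fin L₂ ≃ Fin (L₁ * L₂)) (D : Matrix (Fin n) (Fin N) ℂ) {r : ℕ} (hr : 0 < r) :
    covMoment (compound e fun _ => D) r = (L₁ : ℂ) ^ ((r : ℤ) - 1) * covMoment D r := by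
  obtain ⟨r, rfl⟩ := Nat.exists_eq_succ_of_ne_zero hr.ne'
  have h1 : (L₁ : ℂ) ≠ 0 := by exact_mod_cast hL₁.ne'
  have h2 : (L₂ : ℂ) ≠ 0 := by exact_mod_cast hL₂.ne'
  have ht : (((compound e fun _ => D) * (compound e fun _ => D)ᴴ) ^ (r + 1)).trace =
      (L₂ : ℂ) ^ (r + 1) * (L₁ : ℂ) ^ (r + 1) * ((D * Dᴴ) ^ (r + 1)).trace := by
    rw [compound_const_mul_conjTranspose_pow]
    simp only [Matrix.trace, Matrix.diag_apply, Matrix.of_apply, Fintype.sum_prod_type,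
      Finset.sum_const, Finset.card_univ, Fintype.card_fin, nsmul_eq_mul, ← Finset.mul_sum]
    ring
  have h3 : (((r + 1 : ℕ) : ℤ) - 1) = (r : ℤ) := by push_cast; ring
  rw [covMoment_eq, covMoment_eq, Nat.succ_eq_add_one, ht, h3, zpow_natCast]
  simp only [Fintype.card_prod, Fintype.card_fin, Nat.cast_mul, mul_inv, mul_pow]
  field_simp
  ring

theorem isUnbiased_estimator {k : ℕ} {p : Fin k → ℕ} (hn : 0 < n) (hN : 0 < N)
    (D : Matrix (Fin n) (Fin N) ℂ) {X : Ω → Matrix (Fin n) (Fin N) ℂ}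
    (hX : IsStdComplexGaussian X μ) (hp : ∀ i, 0 < p i) :
    IsUnbiased μ (fun ω => estimator p (D + X ω)) (∏ i, covMoment D (p i)) := by
  have : Nonempty (Fin n) := ⟨⟨0, hn⟩⟩
  have : Nonempty (Fin N) := ⟨⟨0, hN⟩⟩
  have h := isUnbiased_signedSum D hX hp
  simp only [Fintype.card_fin] at h
  exact h

theorem isUnbiased_compoundEstimator {k : ℕ} {p : Fin k → ℕ} (hn : 0 < n) (hN : 0 < N)
    (hL₁ : 0 < L₁) (hL₂ : 0 < L₂) (D : Matrix (Fin n) (Fin N) ℂ)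
    {X : Fin (L₁ * L₂) → Ω → Matrix (Fin n) (Fin N) ℂ}
    (hX : ∀ l, IsStdComplexGaussian (X l) μ)
    (hind : iIndepFun (fun (l : Fin (L₁ * L₂)) (ω : Ω) (s : Fin n × Fin N) => X l ω s.1 s.2) μ)
    (e : Fin L₁ × Fin L₂ ≃ Fin (L₁ * L₂)) (hp : ∀ i, 0 < p i) :
    IsUnbiased μ (fun ω => compoundEstimator p (compound e fun l => D + X l ω))
      (∏ i, covMoment D (p i)) := by
  have : Nonempty (Fin n) := ⟨⟨0, hn⟩⟩
  have : Nonempty (Fin N) := ⟨⟨0, hN⟩⟩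
  have : Nonempty (Fin L₁) := ⟨⟨0, hL₁⟩⟩
  have : Nonempty (Fin L₂) := ⟨⟨0, hL₂⟩⟩
  have hL : (L₁ : ℂ) ≠ 0 := by exact_mod_cast hL₁.ne'
  -- The compound of the `D + X l` is, by definition, the compound of `D` plus that of the noise.
  obtain ⟨h1, h2⟩ := isUnbiased_signedSum (compound e fun _ => D)
    (isStdComplexGaussian_compound e hX hind) hp
  simp only [Fintype.card_prod, Fintype.card_fin, mul_comm L₁, mul_comm L₂] at h1 h2
  refine ⟨h1.const_mul _, ?_⟩
  refine (integral_const_mul _ _).trans ?_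
  refine (congrArg _ h2).trans ?_
  simp_rw [fun i => covMoment_compound_const hL₁ hL₂ e D (hp i)]
  have hprod : ∏ i, (L₁ : ℂ) ^ ((p i : ℤ) - 1) = (L₁ : ℂ) ^ (∑ i, (p i : ℤ) - (k : ℤ)) := by
    simp_rw [zpow_sub₀ hL, zpow_one, zpow_natCast]
    rw [Finset.prod_div_distrib, Finset.prod_pow_eq_pow_sum, Finset.prod_const, Finset.card_univ,
      Fintype.card_fin, ← Nat.cast_sum, zpow_natCast]
  rw [Finset.prod_mul_distrib, hprod, ← mul_assoc, ← zpow_add₀ hL]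
  simp

end Compound

end GaussEst

theorem mainTheorem2 {Ω : Type*} [MeasurableSpace Ω] (μ : Measure Ω) [IsProbabilityMeasure μ]
    (n N : ℕ) (hn : 0 < n) (hN : 0 < N) (D : Matrix (Fin n) (Fin N) ℂ) :
    -- one observation
    (∀ X : Ω → Matrix (Fin n) (Fin N) ℂ, GaussEst.IsStdComplexGaussian X μ →
      (∀ (k : ℕ) (p : Fin k → ℕ), (∀ i, 0 < p i) →
        GaussEst.IsUnbiased μ (fun ω => GaussEst.estimator p (D + X ω))
          (∏ i, GaussEst.covMoment D (p i))) ∧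
      (∀ p : ℕ, 0 < p →
        GaussEst.IsUnbiased μ (fun ω => GaussEst.estimator ![p] (D + X ω))
          (GaussEst.covMoment D p))) ∧
    -- a compound observation matrix formed from independent observations
    (∀ L₁ L₂ : ℕ, 0 < L₁ → 0 < L₂ →
      ∀ X : Fin (L₁ * L₂) → Ω → Matrix (Fin n) (Fin N) ℂ,
      (∀ l, GaussEst.IsStdComplexGaussian (X l) μ) →
      iIndepFun (fun (l : Fin (L₁ * L₂)) (ω : Ω) (s : Fin n × Fin N) => X l ω s.1 s.2) μ →
      ∀ e : Fin L₁ × Fin L₂ ≃ Fin (L₁ * L₂),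
      (∀ (k : ℕ) (p : Fin k → ℕ), (∀ i, 0 < p i) →
        GaussEst.IsUnbiased μ
          (fun ω => GaussEst.compoundEstimator p
            (GaussEst.compound e fun l => D + X l ω))
          (∏ i, GaussEst.covMoment D (p i))) ∧
      (∀ p : ℕ, 0 < p →
        GaussEst.IsUnbiased μ
          (fun ω => GaussEst.compoundEstimator ![p]
            (GaussEst.compound e fun l => D + X l ω))
          (GaussEst.covMoment D p))) := by

  refine ⟨fun X hX => ⟨fun k p hp => GaussEst.isUnbiased_estimator hn hN D hX hp,
    fun p hp => ?_⟩, fun L₁ L₂ hL₁ hL₂ X hX hind e =>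
      ⟨fun k p hp => GaussEst.isUnbiased_compoundEstimator hn hN hL₁ hL₂ D hX hind e hp,
        fun p hp => ?_⟩⟩
  · simpa using GaussEst.isUnbiased_estimator (p := ![p]) hn hN D hX (by simpa using hp)
  · simpa using GaussEst.isUnbiased_compoundEstimator (p := ![p]) hn hN hL₁ hL₂ D hX hind e
      (by simpa using hp)
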